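/- **Definitions.** Let $k$ be a nonnegative integer. A $k$-hypergraph on a finite set $V$ is a set $\mathcal H$ of $k$-element subsets of $V$. For $U\subseteq V$, a vertex $v\in U$ is *dominating in $U$* if every $k$-set $E$ with $v\in E\subseteq U$ lies in $\mathcal H$, and *isolating in $U$* if no such $E$ lies in $\mathcal H$. An *elimination order* is an enumeration $v_1,\dots,v_n$ of $V$ in which each $v_i$ is dominating or isolating in $\{v_1,\dots,v_i\}$; $\mathcal H$ is *orderable* if it has one. A *perfect matching* is a set of pairwise disjoint edges whose union is $V$. As input to a Turing machine, a $k$-hypergraph on $\{1,\dots,n\}$ is given by the string $1^n0w$, where $w$ lists, for all $n^k$ tuples $(x_1,\dots,x_k)$ in lexicographic order, the bit telling whether $\{x_1,\dots,x_k\}\in\mathcal H$; so, for fixed $k$, polynomial in the input length is the same as polynomial in $n$. **Theorem 1.** For every fixed $k$ the following hold. 1. It can be decided in polynomial time whether a given $k$-hypergraph is orderable. 2. It can be decided in polynomial time whether a given orderable $k$-hypergraph has a perfect matching. 3. Orderability is decided by recursively removing a vertex that is dominating or isolating in $V$. That is, let $\mathcal H$ be a $k$-hypergraph on a finite set $V$,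 and for $v\in V$ let $\mathcal H-v:=\{E\in\mathcal H: v\notin E\}$, a $k$-hypergraph on $V\setminus\{v\}$. If $|V|\le k$, then $\mathcal H$ is orderable. If $|V|>k$, then $\mathcal H$ is orderable if and only if some vertex $v$ is dominating or isolating in $V$ and $\mathcal H-v$ is orderable. For every vertex $v$ that is dominating or isolating in $V$, $\mathcal H$ is orderable if and only if $\mathcal H-v$ is (so any such $v$ may be removed). 4. Let $v_1,\dots,v_n$ be an elimination order of a $k$-hypergraph $\mathcal H$. Designate $v_i$ as dominating if it is dominating in $\{v_1,\dots,v_i\}$, and as isolating otherwise. Let $d_j$ and $i_j$ be the numbers of vertices $v_i$ with $i\ge j$ that are designated dominating and isolating, respectively, and let $r_j=(k-1)d_j-i_j$. Then $\mathcal H$ has a perfect matching if and only if $k$ divides $n$ and $r_j\ge 0$ for all $j=1,\dots,n$. -/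

import Mathlib

/-- A `k`-hypergraph on `V`: a set of `k`-element subsets of `V`. -/
@[ext]
structure KHypergraph (k : ℕ) (V : Type*) where
  /-- the set of edges -/
  edges : Set (Finset V)
  /-- every edge has exactly `k` elements -/
  card_eq : ∀ E ∈ edges, E.card = k

namespace KHypergraph

variable {k : ℕ} {V : Type*}

/-- `x` is dominating within `U`: every `k`-set `E` with `x ∈ E ⊆ U` is an edge. -/
def DominatingIn (H : KHypergraph k V) (U : Set V) (x : V) : Prop :=
  ∀ E : Finset V, E.card = k → x ∈ E → (E : Set V) ⊆ U → E ∈ H.edges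

/-- `x` is isolating within `U`: no `k`-set `E` with `x ∈ E ⊆ U` is an edge. -/
def IsolatingIn (H : KHypergraph k V) (U : Set V) (x : V) : Prop :=
  ∀ E : Finset V, E.card = k → x ∈ E → (E : Set V) ⊆ U → E ∉ H.edges

/-- In the enumeration `v` of the vertices, the vertex `v i` is dominating
within `{v j | j ≤ i}`. -/
def DominatingAt (H : KHypergraph k V) {n : ℕ} (v : Fin n ≃ V) (i : Fin n) : Prop :=
  H.DominatingIn (v '' Set.Iic i) (v i)

/-- In the enumeration `v` of the vertices, the vertex `v i` is isolating
within `{v j | j ≤ i}`. -/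
def IsolatingAt (H : KHypergraph k V) {n : ℕ} (v : Fin n ≃ V) (i : Fin n) : Prop :=
  H.IsolatingIn (v '' Set.Iic i) (v i)

/-- The enumeration `v` of the vertices is an elimination order. -/
def IsEliminationOrder (H : KHypergraph k V) {n : ℕ} (v : Fin n ≃ V) : Prop :=
  ∀ i, H.DominatingAt v i ∨ H.IsolatingAt v i

/-- `H` has an elimination order (here `n` is necessarily the number of vertices). -/
def Orderable (H : KHypergraph k V) : Prop :=
  ∃ (n : ℕ) (v : Fin n ≃ V), H.IsEliminationOrder v

/-- The hypergraph `{E ∈ H | E ⊆ V \ {x}}` on the vertex set `V \ {x}`. -/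
def delete (H : KHypergraph k V) (x : V) : KHypergraph k {u : V // u ≠ x} where
  edges := {E | E.map (Function.Embedding.subtype _) ∈ H.edges}
  card_eq E hE := by
    have h := H.card_eq _ hE
    rwa [Finset.card_map] at h

/-- Some set of edges of `H` partitions the vertex set. -/
def HasPerfectMatching (H : KHypergraph k V) : Prop :=
  ∃ M : Finset (Finset V), (∀ E ∈ M, E ∈ H.edges) ∧
    (∀ E ∈ M, ∀ F ∈ M, E ≠ F → Disjoint E F) ∧ ∀ x : V, ∃ E ∈ M, x ∈ E

open Classical in
/-- The number `d_j` of vertices `v i` with `j ≤ i` that are designated dominating. -/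
noncomputable def numDominating (H : KHypergraph k V) {n : ℕ} (v : Fin n ≃ V) (j : Fin n) : ℕ :=
  (Finset.univ.filter fun i : Fin n => j ≤ i ∧ H.DominatingAt v i).card

open Classical in
/-- The number `i_j` of vertices `v i` with `j ≤ i` that are designated isolating.
A vertex that is both dominating and isolating is designated dominating; for `1 ≤ k` these are
exactly the first `k - 1` vertices (or all vertices, if there are fewer). -/
noncomputable def numIsolating (H : KHypergraph k V) {n : ℕ} (v : Fin n ≃ V) (j : Fin n) : ℕ :=
  (Finset.univ.filter fun i : Fin n =>
    j ≤ i ∧ H.IsolatingAt v i ∧ ¬ H.DominatingAt v i).card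

/-- The integer `r_j = (k - 1) d_j - i_j`. -/
noncomputable def balance (H : KHypergraph k V) {n : ℕ} (v : Fin n ≃ V) (j : Fin n) : ℤ :=
  ((k : ℤ) - 1) * H.numDominating v j - H.numIsolating v j

/-- All `k`-tuples of elements of `{0, …, n - 1}`, in lexicographic order. -/
def tuples (n : ℕ) : ℕ → List (List (Fin n))
  | 0 => [[]]
  | k + 1 => (List.finRange n).flatMap fun i => (tuples n k).map fun t => i :: t

open Classical in
/-- The input string `1ⁿ 0 w` of a `k`-hypergraph on `{0, …, n - 1}`, where `w` is its adjacency
tensor: one bit for each of the `nᵏ` tuples `(x₁, …, x_k)` in lexicographic order, telling whether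
`{x₁, …, x_k}` is an edge. For `k = 2` this is the adjacency matrix, row by row. -/
noncomputable def encode (H : Σ n : ℕ, KHypergraph k (Fin n)) : List Bool :=
  List.replicate H.1 true ++
    false :: (tuples H.1 k).map fun t => decide (t.toFinset ∈ H.2.edges)

end KHypergraph

open Classical in
/-- The decision problem `P`, on inputs given as strings by `enc`, is solved by a (multi-stack)
Turing machine in time polynomial in the length of the input string. If the inputs form a subtype,
this is a promise problem: nothing is required on other strings. -/
def DecidableInPolyTime {α Γ : Type} (enc : α → List Γ) (P : α → Prop) : Prop :=
  Nonempty (Turing.TM2ComputableInPolyTime enc Computability.encodeBool fun a => decide (P a))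

/-! ### A structured language of stack programs, and its compilation to Turing machines -/

/-! Being dominating or isolating in `U` only concerns the `k`-sets inside `U`, so it passes to
smaller sets. Hence a removal order stays one after entries are dropped: any removable vertex may be
removed first (`orderable_iff_delete`), and all vertices removable in the same set may be removed
together (`peels_append`). An elimination order is handled through its reversal, a list of vertices
with designations (`IsPeeling`).

For the matching criterion, give a dominating vertex weight `k - 1` and an isolating one weight
`-1`; the numbers `r_j` are then the sums over nonempty prefixes of the removal order. Given a
perfect matching, the first vertex of each edge still sees the whole edge, so it must be designated
dominating, and its weight pays for the at most `k - 1` other vertices of that edge in a prefix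
(`IsPeeling.balanced_of_matching`). Conversely, if no prefix sum is negative, the first vertex is
dominating and forms an edge with any `k - 1` later vertices. `Balanced.exists_take` chooses these
greedily, taking isolating vertices as they come and dominating ones only when forced, so that the
rest stays balanced; induction finishes (`exists_matching_of_balanced`).

The algorithm works in rounds, each removing every vertex that is removable in the current set. In
an orderable hypergraph every nonempty set has a removable vertex, so `n` rounds empty the vertex
set (`card_nextSet`). A running balance and a count of its failures decide the matching problem. To
test a vertex `x`, a conjunction is taken over the `k`-tuples starting with `x` whose entries are
distinct and present. On stacks, a tensor marking these tuples is grown one coordinate at a time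
(`valid_snoc_snoc`), compared with the input, and folded back by conjunctions over the last
coordinate. For fixed `k` this takes boundedly many polynomial-time passes. The relation `Run`
carries the step bounds, and `Run.leads` transfers them to Turing machines. The case `k = 0` is
treated apart. -/

/-- A store `S` holding one stack of bits for every `k : K`. -/
class StackMemory (K : outParam Type) (S : Type) [DecidableEq K] where
  /-- the content of a stack -/
  get : S → K → List Bool
  /-- replace the content of a stack -/
  set : K → List Bool → S → S
  get_set : ∀ k l s, get (set k l s) = Function.update (get s) k l
  get_injective : Function.Injective get

/-- Structured programs acting on stacks of bits. -/
inductive StackProg (K : Type) : Type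
  /-- do nothing -/
  | skip : StackProg K
  /-- push a bit -/
  | push (k : K) (b : Bool) : StackProg K
  /-- run two programs in sequence -/
  | seq (p q : StackProg K) : StackProg K
  /-- pop a bit and continue according to its value, or with `p` if the stack was empty -/
  | pop (k : K) (p : StackProg K) (q : Bool → StackProg K) : StackProg K
  /-- pop a bit `b` and run `q b`, until the stack is found empty -/
  | loop (k : K) (q : Bool → StackProg K) : StackProg K

namespace StackProg

open StackMemory

/-- `Run p s T s'`: started in the store `s`, the program `p` ends in `s'` after at most `T`
steps. -/
inductive Run {K S : Type} [DecidableEq K] [StackMemory K S] :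
    StackProg K → S → ℕ → S → Prop
  | skip (s : S) : Run .skip s 1 s
  | push (k : K) (b : Bool) (s : S) : Run (.push k b) s 1 (set k (b :: get s k) s)
  | seq {p q : StackProg K} {s₁ s₂ s₃ : S} {T₁ T₂ : ℕ} (h₁ : Run p s₁ T₁ s₂)
      (h₂ : Run q s₂ T₂ s₃) : Run (.seq p q) s₁ (T₁ + T₂) s₃
  | pop_nil {k : K} {p : StackProg K} {q : Bool → StackProg K} {s s' : S} {T : ℕ}
      (hs : get s k = []) (h : Run p (set k [] s) T s') : Run (.pop k p q) s (1 + T) s'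
  | pop_cons {k : K} {p : StackProg K} {q : Bool → StackProg K} {s s' : S} {T : ℕ} {b : Bool}
      {l : List Bool} (hs : get s k = b :: l) (h : Run (q b) (set k l s) T s') :
      Run (.pop k p q) s (1 + T) s'
  | loop_nil {k : K} {q : Bool → StackProg K} {s : S} (hs : get s k = []) :
      Run (.loop k q) s 1 (set k [] s)
  | loop_cons {k : K} {q : Bool → StackProg K} {s₁ s₂ s₃ : S} {T₁ T₂ : ℕ} {b : Bool}
      {l : List Bool} (hs : get s₁ k = b :: l) (h₁ : Run (q b) (set k l s₁) T₁ s₂)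
      (h₂ : Run (.loop k q) s₂ T₂ s₃) : Run (.loop k q) s₁ (1 + T₁ + T₂) s₃
  | mono {p : StackProg K} {s₁ s₂ : S} {T T' : ℕ} (h : Run p s₁ T s₂) (hT : T ≤ T') :
      Run p s₁ T' s₂

/-- The labels of the machine code of a program. -/
def Pos {K : Type} : StackProg K → Type
  | skip => Unit
  | push _ _ => Unit
  | seq p q => p.Pos ⊕ q.Pos
  | pop _ p q => Option (p.Pos ⊕ Σ b : Bool, (q b).Pos)
  | loop _ q => Option (Σ b : Bool, (q b).Pos)

/-- There are finitely many labels. -/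
@[reducible]
noncomputable def fintypePos {K : Type} : (p : StackProg K) → Fintype p.Pos
  | skip => inferInstanceAs (Fintype Unit)
  | push _ _ => inferInstanceAs (Fintype Unit)
  | seq p q =>
    letI := p.fintypePos
    letI := q.fintypePos
    inferInstanceAs (Fintype (p.Pos ⊕ q.Pos))
  | pop _ p q =>
    letI := p.fintypePos
    letI := fun b => (q b).fintypePos
    inferInstanceAs (Fintype (Option (p.Pos ⊕ Σ b : Bool, (q b).Pos)))
  | loop _ q =>
    letI := fun b => (q b).fintypePos
    inferInstanceAs (Fintype (Option (Σ b : Bool, (q b).Pos)))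

/-- The label at which a program starts. -/
def entry {K : Type} : (p : StackProg K) → p.Pos
  | skip => ()
  | push _ _ => ()
  | seq p _ => Sum.inl p.entry
  | pop _ _ _ => none
  | loop _ _ => none

/-- The statements of the Turing machines produced here; the internal state holds the last bit
that was popped. -/
abbrev Code (K Λ : Type) : Type := Turing.TM2.Stmt (fun _ : K => Bool) Λ (Option Bool)

open Turing.TM2.Stmt in
/-- The machine code of a program, where `emb` places its labels and `exit` is the label at which
to continue. -/
def code {K Λ : Type} : (p : StackProg K) → (p.Pos → Λ) → Λ → p.Pos → Code K Λ
  | skip, _, exit, _ => goto fun _ => exit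
  | .push k b, _, exit, _ => .push k (fun _ => b) (goto fun _ => exit)
  | seq p q, emb, exit, x =>
    match x with
    | Sum.inl y => p.code (emb ∘ Sum.inl) (emb (Sum.inr q.entry)) y
    | Sum.inr y => q.code (emb ∘ Sum.inr) exit y
  | .pop k p q, emb, exit, x =>
    match x with
    | none => .pop k (fun _ o => o) (goto fun o =>
        match o with
        | none => emb (some (Sum.inl p.entry))
        | some b => emb (some (Sum.inr ⟨b, (q b).entry⟩)))
    | some (Sum.inl y) => p.code (fun z => emb (some (Sum.inl z))) exit y
    | some (Sum.inr y) => (q y.1).code (fun z => emb (some (Sum.inr ⟨y.1, z⟩))) exit y.2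
  | loop k q, emb, exit, x =>
    match x with
    | none => .pop k (fun _ o => o) (goto fun o =>
        match o with
        | none => exit
        | some b => emb (some ⟨b, (q b).entry⟩))
    | some y => (q y.1).code (fun z => emb (some ⟨y.1, z⟩)) (emb none) y.2

section Compile

variable {K S Λ : Type} [DecidableEq K] [StackMemory K S]

/-- The machine `M` gets from label `l` and store `s` to label `l'` and store `s'` in at most `T`
steps, whatever its internal state is. -/
def Leads (M : Λ → Code K Λ) (l : Λ) (s : S) (T : ℕ) (l' : Λ) (s' : S) : Prop :=
  ∀ v : Option Bool, ∃ v' : Option Bool, ∃ t ≤ T,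
    (flip bind (Turing.TM2.step M))^[t] (some ⟨some l, v, get s⟩) = some ⟨some l', v', get s'⟩

theorem Leads.trans {M : Λ → Code K Λ} {l₁ l₂ l₃ : Λ} {s₁ s₂ s₃ : S} {T₁ T₂ : ℕ}
    (h₁ : Leads M l₁ s₁ T₁ l₂ s₂) (h₂ : Leads M l₂ s₂ T₂ l₃ s₃) :
    Leads M l₁ s₁ (T₁ + T₂) l₃ s₃ := by
  intro v
  obtain ⟨v', t₁, ht₁, e₁⟩ := h₁ v
  obtain ⟨v'', t₂, ht₂, e₂⟩ := h₂ v'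
  refine ⟨v'', t₂ + t₁, by omega, ?_⟩
  rw [Function.iterate_add_apply, e₁, e₂]

theorem Leads.of_step {M : Λ → Code K Λ} {l l' : Λ} {s s' : S}
    (h : ∀ v, ∃ v', Turing.TM2.stepAux (M l) v (get s) = ⟨some l', v', get s'⟩) :
    Leads M l s 1 l' s' := by
  intro v
  obtain ⟨v', e⟩ := h v
  exact ⟨v', 1, le_rfl, congrArg some e⟩

/-- Correctness of the compilation, by induction on the run. Keeping `emb` and `exit` arbitrary lets
the induction hypothesis apply to a subprogram whose labels are only part of those of the whole
machine. -/
theorem Run.leads {M : Λ → Code K Λ} {p : StackProg K} {s s' : S} {T : ℕ} (h : Run p s T s') :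
    ∀ (emb : p.Pos → Λ) (exit : Λ), (∀ x, M (emb x) = p.code emb exit x) →
      Leads M (emb p.entry) s T exit s' := by
  induction h with
  | skip s =>
    intro emb exit hM
    refine Leads.of_step fun v => ⟨v, ?_⟩
    rw [hM]
    rfl
  | push k b s =>
    intro emb exit hM
    refine Leads.of_step fun v => ⟨v, ?_⟩
    rw [hM, get_set]
    rfl
  | seq h₁ h₂ ih₁ ih₂ =>
    intro emb exit hM
    exact (ih₁ _ _ fun x => hM (Sum.inl x)).trans (ih₂ _ _ fun x => hM (Sum.inr x))
  | @pop_nil k p q s s' T hs h ih =>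
    intro emb exit hM
    refine Leads.trans (Leads.of_step fun v => ⟨none, ?_⟩) (ih _ _ fun x => hM (some (Sum.inl x)))
    rw [hM, get_set]
    simp [entry, code, hs]
  | @pop_cons k p q s s' T b l hs h ih =>
    intro emb exit hM
    refine Leads.trans (Leads.of_step fun v => ⟨some b, ?_⟩)
      (ih _ _ fun x => hM (some (Sum.inr ⟨b, x⟩)))
    rw [hM, get_set]
    simp [entry, code, hs]
  | @loop_nil k q s hs =>
    intro emb exit hM
    refine Leads.of_step fun v => ⟨none, ?_⟩
    rw [hM, get_set]
    simp [entry, code, hs]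
  | @loop_cons k q s₁ s₂ s₃ T₁ T₂ b l hs h₁ h₂ ih₁ ih₂ =>
    intro emb exit hM
    -- The body exits to the loop head `emb none`, so the remaining iterations satisfy the same
    -- hypothesis `hM`.
    refine Leads.trans (Leads.trans (Leads.of_step fun v => ⟨some b, ?_⟩)
      (ih₁ _ _ fun x => hM (some ⟨b, x⟩))) (ih₂ _ _ hM)
    rw [hM, get_set]
    simp [entry, code, hs]
  | mono h hT ih =>
    intro emb exit hM v
    obtain ⟨v', t, ht, e⟩ := ih emb exit hM v
    exact ⟨v', t, ht.trans hT, e⟩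

/-- The machine code of a program that is to be run on its own. -/
def program (p : StackProg K) : Option p.Pos → Code K (Option p.Pos)
  | none => .load (fun _ => none) .halt
  | some x => p.code some none x

/-- The Turing machine executing a program, with one stack for input and output. -/
noncomputable def machine [Fintype K] (p : StackProg K) (io : K) : Turing.FinTM2 :=
  letI := p.fintypePos
  { K := K
    k₀ := io
    k₁ := io
    Γ := fun _ => Bool
    Λ := Option p.Pos
    main := some p.entry
    σ := Option Bool
    initialState := none
    Γk₀Fin := inferInstanceAs (Fintype Bool)
    m := p.program }

theorem initList_machine [Fintype K] (p : StackProg K) (io : K) (l : List Bool) :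
    Turing.initList (p.machine io) l =
      (⟨some (some p.entry), none, Function.update (fun _ => []) io l⟩ :
        Turing.TM2.Cfg (fun _ : K => Bool) (Option p.Pos) (Option Bool)) := by
  refine congrArg (Turing.TM2.Cfg.mk _ _) (funext fun (k : K) => ?_)
  by_cases hk : k = io
  · subst hk
    exact (dif_pos rfl).trans
      (Function.update_self (β := fun _ => List Bool) k l fun _ => []).symm
  · exact (dif_neg hk).trans
      (Function.update_of_ne (β := fun _ => List Bool) hk l fun _ => []).symm

theorem haltList_machine [Fintype K] (p : StackProg K) (io : K) (l : List Bool) :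
    Turing.haltList (p.machine io) l =
      (⟨none, none, Function.update (fun _ => []) io l⟩ :
        Turing.TM2.Cfg (fun _ : K => Bool) (Option p.Pos) (Option Bool)) := by
  refine congrArg (Turing.TM2.Cfg.mk _ _) (funext fun (k : K) => ?_)
  by_cases hk : k = io
  · subst hk
    exact (dif_pos rfl).trans
      (Function.update_self (β := fun _ => List Bool) k l fun _ => []).symm
  · exact (dif_neg hk).trans
      (Function.update_of_ne (β := fun _ => List Bool) hk l fun _ => []).symm

/-- A problem decided by a structured stack program in polynomial time is decidable in polynomial
time. -/
theorem decidableInPolyTime [Fintype K] {α : Type} {enc : α → List Bool} {P : α → Prop}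
    (p : StackProg K) (io : K) (time : Polynomial ℕ)
    (h : ∀ a, ∃ (s s' : S), get s = Function.update (fun _ => []) io (enc a) ∧
      get s' = Function.update (fun _ => []) io (open Classical in [decide (P a)]) ∧
      Run p s (time.eval (enc a).length) s') :
    DecidableInPolyTime enc P := by
  have key : ∀ a, ∃ t ≤ time.eval (enc a).length + 1,
      (flip bind (p.machine io).step)^[t] (some (Turing.initList (p.machine io) (enc a))) =
        some (Turing.haltList (p.machine io) (open Classical in [decide (P a)])) := by
    intro a
    obtain ⟨s, s', hs, hs', hr⟩ := h a
    obtain ⟨v', t, ht, e⟩ := hr.leads (M := p.program) some none (fun x => rfl) none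
    -- The extra step is at the label `none`: it resets the internal state, as a halting
    -- configuration requires, and halts.
    refine ⟨1 + t, by omega, ?_⟩
    rw [hs] at e
    refine (congrArg _ (congrArg some (initList_machine p io (enc a)))).trans ?_
    refine Eq.trans ?_ (congrArg some (haltList_machine p io _)).symm
    rw [Function.iterate_add_apply]
    refine (congrArg _ e).trans ?_
    rw [hs']
    rfl
  refine ⟨{ tm := p.machine io
            inputAlphabet := Equiv.refl Bool
            outputAlphabet := Equiv.refl Bool
            time := time + 1
            outputsFun := fun a => ?_ }⟩
  have := (key a).choose_spec
  refine ⟨⟨(key a).choose, ?_⟩, by simpa using this.1⟩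
  refine Eq.trans ?_ (this.2.trans rfl)
  erw [List.map_id]

end Compile

end StackProg

/-! ### Removal orders and deletion of vertices -/

namespace KHypergraph

section Peeling

variable {k : ℕ} {V : Type*}

/-- `x` is dominating (if `δ`) or isolating (if not) within `U`. -/
def RemovableAs (H : KHypergraph k V) (U : Set V) (x : V) (δ : Bool) : Prop :=
  if δ then H.DominatingIn U x else H.IsolatingIn U x

theorem RemovableAs.mono {H : KHypergraph k V} {U U' : Set V} {x : V} {δ : Bool}
    (h : H.RemovableAs U x δ) (hU : U' ⊆ U) : H.RemovableAs U' x δ := by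
  cases δ
  · exact fun E h₁ h₂ h₃ => h E h₁ h₂ (h₃.trans hU)
  · exact fun E h₁ h₂ h₃ => h E h₁ h₂ (h₃.trans hU)

theorem exists_removableAs {H : KHypergraph k V} {U : Set V} {x : V} :
    (∃ δ, H.RemovableAs U x δ) ↔ H.DominatingIn U x ∨ H.IsolatingIn U x := by
  simp [RemovableAs, or_comm]

/-- The designated vertices of `L` can be removed one after the other: each is dominating or
isolating, as designated, among itself and the later ones. -/
def Peels (H : KHypergraph k V) : List (V × Bool) → Prop
  | [] => True
  | e :: L => H.RemovableAs {y | y ∈ (e :: L).map Prod.fst} e.1 e.2 ∧ H.Peels L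

/-- Dropping entries only shrinks the set in which each remaining entry has to be removable. -/
theorem Peels.sublist {H : KHypergraph k V} {L L' : List (V × Bool)} (h : H.Peels L)
    (hL : L'.Sublist L) : H.Peels L' := by
  induction hL with
  | slnil => trivial
  | cons a _ ih => exact ih h.2
  | cons_cons a hs ih =>
    exact ⟨h.1.mono fun y hy => (hs.cons_cons a).map Prod.fst |>.subset hy, ih h.2⟩

theorem peels_of_forall {H : KHypergraph k V} {L : List (V × Bool)}
    (h : ∀ e ∈ L, H.RemovableAs Set.univ e.1 e.2) : H.Peels L := by
  induction L with
  | nil => trivial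
  | cons e L ih =>
    exact ⟨(h e (by simp)).mono (Set.subset_univ _), ih fun e he => h e (by simp [he])⟩

/-- `L` is a removal order of all vertices. -/
structure IsPeeling (H : KHypergraph k V) (L : List (V × Bool)) : Prop where
  peels : H.Peels L
  nodup : (L.map Prod.fst).Nodup
  mem : ∀ x, x ∈ L.map Prod.fst

open Classical in
/-- The removal order belonging to an elimination order. -/
noncomputable def peelingOf (H : KHypergraph k V) {n : ℕ} (v : Fin n ≃ V) : List (V × Bool) :=
  (List.finRange n).reverse.map fun i => (v i, decide (H.DominatingAt v i))

theorem IsEliminationOrder.isPeeling {H : KHypergraph k V} {n : ℕ} {v : Fin n ≃ V}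
    (h : H.IsEliminationOrder v) : H.IsPeeling (H.peelingOf v) where
  peels := by
    have key : ∀ I : List (Fin n), I.Pairwise (· > ·) →
        H.Peels (I.map fun i => (v i, open Classical in decide (H.DominatingAt v i))) := by
      intro I hI
      induction I with
      | nil => trivial
      | cons i I ih =>
        rw [List.pairwise_cons] at hI
        refine ⟨?_, ih hI.2⟩
        have hi : H.RemovableAs (v '' Set.Iic i) (v i)
            (open Classical in decide (H.DominatingAt v i)) := by
          by_cases hd : H.DominatingAt v i
          · simp only [RemovableAs, hd, decide_true, if_true]
            exact hd
          · simp only [RemovableAs, hd, decide_false]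
            exact (h i).resolve_left hd
        refine hi.mono ?_
        rintro y hy
        simp only [List.map_cons, List.map_map, Set.mem_ofPred_eq, List.mem_cons,
          List.mem_map] at hy
        rcases hy with rfl | ⟨j, hj, rfl⟩
        · exact ⟨i, Set.mem_Iic.2 le_rfl, rfl⟩
        · exact ⟨j, Set.mem_Iic.2 (hI.1 j hj).le, rfl⟩
    exact key _ (List.pairwise_reverse.2 (List.pairwise_lt_finRange n))
  nodup := by
    simp only [peelingOf, List.map_map]
    exact (List.nodup_reverse.2 (List.nodup_finRange n)).map v.injective
  mem x := by
    simp only [peelingOf, List.map_map]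
    exact List.mem_map.2 ⟨v.symm x, by simp, by simp⟩

theorem orderable_iff_exists_isPeeling {H : KHypergraph k V} :
    H.Orderable ↔ ∃ L, H.IsPeeling L := by
  classical
  constructor
  · rintro ⟨n, v, hv⟩
    exact ⟨_, hv.isPeeling⟩
  · rintro ⟨L, hL⟩
    -- Elimination runs against removal: index `i` becomes position `i.rev`, and the vertices up to
    -- `i` form the tail of `L` from there on.
    refine ⟨_, Fin.revPerm.trans (hL.nodup.getEquivOfForallMemList _ hL.mem), fun i => ?_⟩
    have hi : (i.rev : ℕ) < L.length := by simpa using i.rev.2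
    have hd := hL.peels.sublist (List.drop_sublist i.rev L)
    rw [List.drop_eq_getElem_cons hi] at hd
    have := exists_removableAs.1 ⟨_, hd.1⟩
    rw [← List.drop_eq_getElem_cons hi] at this
    have hs : ((Fin.revPerm.trans (hL.nodup.getEquivOfForallMemList _ hL.mem)) '' Set.Iic i) ⊆
        {y | y ∈ (L.drop i.rev).map Prod.fst} := by
      rintro _ ⟨j, hj, rfl⟩
      have hji : (i.rev : ℕ) ≤ j.rev := Fin.rev_le_rev.2 hj
      simp only [Set.mem_ofPred_eq, List.map_drop, Equiv.trans_apply, Fin.revPerm_apply,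
        List.Nodup.getEquivOfForallMemList_apply, List.get_eq_getElem]
      rw [List.mem_iff_getElem]
      refine ⟨j.rev - i.rev, ?_, ?_⟩
      · have := j.rev.2
        simp only [List.length_drop]
        omega
      · rw [List.getElem_drop]
        congr 1
        omega
    have hx : (Fin.revPerm.trans (hL.nodup.getEquivOfForallMemList _ hL.mem)) i =
        (L[(i.rev : ℕ)]).1 := by
      simp
    rw [DominatingAt, IsolatingAt, hx]
    exact this.imp (fun h E h₁ h₂ h₃ => h E h₁ h₂ (h₃.trans hs))
      (fun h E h₁ h₂ h₃ => h E h₁ h₂ (h₃.trans hs))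

/-- The only possible edge is the whole vertex set. If it is an edge, all vertices are dominating;
if not, all are isolating. -/
theorem orderable_of_card_le [Finite V] {H : KHypergraph k V} (h : Nat.card V ≤ k) :
    H.Orderable := by
  classical
  have := Fintype.ofFinite V
  rw [Nat.card_eq_fintype_card] at h
  have huniv : ∀ E : Finset V, E.card = k → E = Finset.univ := fun E hE =>
    Finset.eq_univ_of_card E (le_antisymm (Finset.card_le_univ E) (hE ▸ h))
  refine orderable_iff_exists_isPeeling.2
    ⟨Finset.univ.toList.map fun x => (x, decide H.edges.Nonempty), peels_of_forall ?_, ?_, ?_⟩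
  · intro e he
    obtain ⟨x, -, rfl⟩ := List.mem_map.1 he
    by_cases hne : H.edges.Nonempty
    · simp only [RemovableAs, hne, decide_true, if_true]
      intro E hE _ _
      obtain ⟨F, hF⟩ := hne
      rwa [huniv E hE, ← huniv F (H.card_eq F hF)]
    · simp only [RemovableAs, hne, decide_false]
      exact fun E _ _ _ hE => hne ⟨E, hE⟩
  · simpa [List.map_map, Function.comp_def] using Finset.nodup_toList _
  · simp

/-- The `k`-sets of the subtype correspond to the `k`-sets of `V` avoiding `x`, and edges to edges.
-/
theorem delete_removableAs {H : KHypergraph k V} {x : V} {U : Set {u : V // u ≠ x}}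
    {y : {u : V // u ≠ x}} {δ : Bool} :
    (H.delete x).RemovableAs U y δ ↔ H.RemovableAs (Subtype.val '' U) y δ := by
  classical
  have key : ∀ p : Finset V → Prop,
      (∀ E : Finset {u : V // u ≠ x}, E.card = k → y ∈ E → (E : Set _) ⊆ U →
        p (E.map (Function.Embedding.subtype _))) ↔
      (∀ E : Finset V, E.card = k → (y : V) ∈ E → (E : Set V) ⊆ Subtype.val '' U → p E) := by
    intro p
    constructor
    · intro h E h₁ h₂ h₃
      have hE : (E.subtype (· ≠ x)).map (Function.Embedding.subtype _) = E := by
        rw [Finset.subtype_map_of_mem]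
        intro z hz
        obtain ⟨w, -, rfl⟩ := h₃ hz
        exact w.2
      rw [← hE]
      refine h _ ?_ ?_ ?_
      · rw [← Finset.card_map, hE, h₁]
      · simpa using h₂
      · intro z hz
        obtain ⟨w, hw, hwz⟩ := h₃ (show (z : V) ∈ E by simpa using hz)
        rwa [← Subtype.ext hwz]
    · intro h E h₁ h₂ h₃
      refine h _ (by simpa using h₁) (by simpa using ⟨y.2, h₂⟩) ?_
      intro z hz
      simp only [Finset.coe_map, Set.mem_image] at hz
      obtain ⟨w, hw, rfl⟩ := hz
      exact ⟨w, h₃ hw, rfl⟩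
  cases δ
  · exact key fun E => E ∉ H.edges
  · exact key fun E => E ∈ H.edges

theorem delete_peels {H : KHypergraph k V} {x : V} {L : List ({u : V // u ≠ x} × Bool)} :
    (H.delete x).Peels L ↔ H.Peels (L.map fun e => ((e.1 : V), e.2)) := by
  induction L with
  | nil => simp [Peels]
  | cons e L ih =>
    have hset : Subtype.val '' {y | y ∈ (e :: L).map Prod.fst} =
        {y | y ∈ ((e :: L).map fun e => ((e.1 : V), e.2)).map Prod.fst} := by
      ext z
      simp only [List.map_map, Set.mem_image, Set.mem_ofPred_eq, List.mem_map, Function.comp]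
      constructor
      · rintro ⟨_, ⟨e, he, rfl⟩, rfl⟩
        exact ⟨e, he, rfl⟩
      · rintro ⟨e, he, rfl⟩
        exact ⟨_, ⟨e, he, rfl⟩, rfl⟩
    refine and_congr ?_ ih
    rw [delete_removableAs, hset]
    rfl

/-- Forwards, `x` is filtered out of any removal order, wherever it stands. Backwards, `x` is put in
front, which is allowed because it is removable in the whole vertex set. -/
theorem orderable_iff_delete {H : KHypergraph k V} {x : V}
    (hx : H.DominatingIn Set.univ x ∨ H.IsolatingIn Set.univ x) :
    H.Orderable ↔ (H.delete x).Orderable := by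
  classical
  rw [orderable_iff_exists_isPeeling, orderable_iff_exists_isPeeling]
  constructor
  · rintro ⟨L, h₁, h₂, h₃⟩
    have hp : ∀ e ∈ L.filter (fun e => e.1 ≠ x), e.1 ≠ x := fun e he => by
      simpa using (List.mem_filter.1 he).2
    have hmap : ((L.filter (fun e => e.1 ≠ x)).pmap
        (fun e h => ((⟨e.1, h⟩ : {u : V // u ≠ x}), e.2)) hp).map (fun e => ((e.1 : V), e.2)) =
        L.filter (fun e => e.1 ≠ x) := by
      rw [List.map_pmap]
      simp
    refine ⟨(L.filter (fun e => e.1 ≠ x)).pmap (fun e h => (⟨e.1, h⟩, e.2)) hp, ?_, ?_, ?_⟩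
    · rw [delete_peels, hmap]
      exact h₁.sublist List.filter_sublist
    · refine List.Nodup.of_map Subtype.val ?_
      rw [List.map_map]
      have := (h₂.sublist ((List.filter_sublist (p := fun e => decide (e.1 ≠ x))).map Prod.fst))
      rw [← hmap, List.map_map] at this
      exact this
    · intro y
      obtain ⟨e, he, hey⟩ := List.mem_map.1 (h₃ y)
      have hy := y.2
      rw [← hey] at hy
      refine List.mem_map.2 ⟨(⟨e.1, hy⟩, e.2), ?_, Subtype.ext hey⟩
      exact List.mem_pmap.2 ⟨e, List.mem_filter.2 ⟨he, by simpa using hy⟩, rfl⟩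
  · rintro ⟨L, h₁, h₂, h₃⟩
    obtain ⟨δ, hδ⟩ := exists_removableAs.2 hx
    refine ⟨(x, δ) :: L.map fun e => ((e.1 : V), e.2),
      ⟨hδ.mono (Set.subset_univ _), delete_peels.1 h₁⟩, ?_, ?_⟩
    · rw [List.map_cons, List.nodup_cons, List.map_map]
      constructor
      · intro h
        obtain ⟨e, -, he⟩ := List.mem_map.1 h
        exact e.1.2 he
      · have := h₂.map Subtype.val_injective
        rwa [List.map_map] at this
    · intro y
      by_cases hy : y = x
      · simp [hy]
      · obtain ⟨e, he, hey⟩ := List.mem_map.1 (h₃ ⟨y, hy⟩)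
        rw [List.map_cons, List.map_map]
        exact List.mem_cons_of_mem _ (List.mem_map.2 ⟨e, he, by simp [hey]⟩)

/-- The head of a removal order is removable in the whole vertex set; the bound on `k` ensures that
there is a head. -/
theorem orderable_iff_exists_delete [Finite V] {H : KHypergraph k V} (h : k < Nat.card V) :
    H.Orderable ↔ ∃ x : V, (H.DominatingIn Set.univ x ∨ H.IsolatingIn Set.univ x) ∧
      (H.delete x).Orderable := by
  constructor
  · intro ho
    obtain ⟨L, hL⟩ := orderable_iff_exists_isPeeling.1 ho
    cases L with
    | nil =>
      have : IsEmpty V := ⟨fun x => by simpa using hL.mem x⟩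
      simp at h
    | cons e L =>
      have hx := exists_removableAs.1 ⟨_, hL.peels.1⟩
      rw [Set.eq_univ_of_forall (s := {y | y ∈ (e :: L).map Prod.fst}) hL.mem] at hx
      exact ⟨e.1, hx, (orderable_iff_delete hx).1 ho⟩
  · rintro ⟨x, hx, ho⟩
    exact (orderable_iff_delete hx).2 ho

end Peeling

end KHypergraph

/-! ### The criterion for a perfect matching -/

namespace KHypergraph

section Matching

variable {k : ℕ} {V : Type*}

/-- The contribution of a designated vertex to the balance. -/
def weight (k : ℕ) (δ : Bool) : ℤ := if δ then k - 1 else -1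

/-- All partial sums of the weights of `L` are at least `-s`. -/
def Balanced (k : ℕ) : ℤ → List (V × Bool) → Prop
  | s, [] => 0 ≤ s
  | s, e :: L => 0 ≤ s ∧ Balanced k (s + weight k e.2) L

theorem Balanced.nonneg {s : ℤ} {L : List (V × Bool)} (h : Balanced k s L) : 0 ≤ s := by
  cases L with
  | nil => exact h
  | cons e L => exact h.1

theorem balanced_iff {s : ℤ} {L : List (V × Bool)} :
    Balanced k s L ↔ ∀ m, 0 ≤ s + ((L.take m).map fun e => weight k e.2).sum := by
  induction L generalizing s with
  | nil => simp [Balanced]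
  | cons e L ih =>
    rw [Balanced, ih]
    constructor
    · rintro ⟨h₁, h₂⟩ m
      cases m with
      | zero => simpa using h₁
      | succ m => simpa [add_assoc] using h₂ m
    · exact fun h => ⟨by simpa using h 0, fun m => by simpa [add_assoc] using h (m + 1)⟩

/-- If `c` units are available on top of `b`, then `c` members can be taken out. -/
theorem Balanced.exists_take {L : List (V × Bool)} {c : ℕ} {b : ℤ} (hb : 0 ≤ b) (hk : 1 ≤ k)
    (h : Balanced k (b + c) L) (hc : c ≤ L.length) :
    ∃ t r : List (V × Bool), t.length = c ∧ r.Sublist L ∧ L.Perm (t ++ r) ∧ Balanced k b r := by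
  induction L generalizing c b with
  | nil =>
    obtain rfl : c = 0 := by simpa using hc
    exact ⟨[], [], rfl, .refl _, .refl _, hb⟩
  | cons e L ih =>
    obtain ⟨y, δ⟩ := e
    rcases Nat.eq_zero_or_pos c with rfl | hpos
    · exact ⟨[], _, rfl, .refl _, .refl _, by simpa using h⟩
    cases δ with
    | true =>
      rcases Nat.lt_or_ge L.length c with hlt | hge
      -- Here `c` is the length of the whole list, so everything has to be taken out.
      · exact ⟨(y, true) :: L, [], by simp at hc ⊢; omega, List.nil_sublist _, by simp, hb⟩
      -- The dominating vertex is kept; its weight raises the floor from `b` to `b + (k - 1)` for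
      -- what follows.
      · have h' : Balanced k ((b + (k - 1)) + c) L := by
          have := h.2
          simp only [weight, if_true] at this
          rwa [show b + (k - 1) + c = b + c + ((k : ℤ) - 1) by ring]
        obtain ⟨t, r, h₁, h₂, h₃, h₄⟩ := ih (by omega) h' hge
        refine ⟨t, (y, true) :: r, h₁, h₂.cons_cons _, ?_, hb, by simpa [weight] using h₄⟩
        exact (h₃.cons _).trans List.perm_middle.symm
    | false =>
      obtain ⟨c, rfl⟩ := Nat.exists_eq_succ_of_ne_zero hpos.ne'
      -- The isolating vertex is taken out; its cost of one unit is covered by lowering `c` by one.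
      have h' : Balanced k (b + c) L := by
        have := h.2
        simpa [weight, add_assoc] using this
      obtain ⟨t, r, h₁, h₂, h₃, h₄⟩ := ih hb h' (by simpa using hc)
      exact ⟨(y, false) :: t, r, by simp [h₁], h₂.cons _, h₃.cons _, h₄⟩

/-- Induction on the number of edges. The first vertex supplies `k - 1` units, exactly what is
needed to take out `k - 1` partners and leave a list that is balanced from `0`. These `k` vertices
form an edge because the first one is dominating among all that remain. -/
theorem exists_matching_of_balanced {H : KHypergraph k V} (m : ℕ) {L : List (V × Bool)}
    (hlen : L.length = k * m) (hp : H.Peels L) (hnd : (L.map Prod.fst).Nodup)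
    (hb : Balanced k 0 L) :
    ∃ M : Finset (Finset V), (∀ E ∈ M, E ∈ H.edges) ∧
      (∀ E ∈ M, ∀ F ∈ M, E ≠ F → Disjoint E F) ∧
      ∀ x : V, (∃ E ∈ M, x ∈ E) ↔ x ∈ L.map Prod.fst := by
  classical
  induction m generalizing L with
  | zero =>
    obtain rfl : L = [] := by simpa using hlen
    exact ⟨∅, by simp⟩
  | succ m ih =>
    cases L with
    | nil => exact ⟨∅, by simp⟩
    | cons e L =>
      obtain ⟨x, δ⟩ := e
      cases δ with
      | false =>
        -- An isolating vertex in front would bring the balance to `-1` at once.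
        have := hb.2.nonneg
        simp [weight] at this
      | true =>
        rw [List.length_cons, Nat.mul_succ] at hlen
        have hk : 1 ≤ k := by
          rcases Nat.eq_zero_or_pos k with rfl | h
          · simp at hlen
          · exact h
        have hb' : Balanced k (0 + (k - 1 : ℕ)) L := by
          have := hb.2
          simp only [weight, if_true] at this
          rwa [Nat.cast_sub hk, Nat.cast_one]
        obtain ⟨t, r, ht, hr, hperm, hbr⟩ := hb'.exists_take le_rfl hk (by omega)
        have hperm' := hperm.map Prod.fst
        rw [List.map_append] at hperm'
        have hnd' : (x :: (t.map Prod.fst ++ r.map Prod.fst)).Nodup :=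
          (hperm'.cons x).nodup_iff.1 hnd
        have hlr : r.length = k * m := by
          have := hperm.length_eq
          rw [List.length_append] at this
          omega
        obtain ⟨M, hM₁, hM₂, hM₃⟩ := ih hlr (hp.2.sublist hr)
          ((List.nodup_append.1 (List.nodup_cons.1 hnd').2).2.1) hbr
        set E : Finset V := (x :: t.map Prod.fst).toFinset with hE
        have hdisj : ∀ F ∈ M, Disjoint E F := by
          intro F hF
          rw [Finset.disjoint_left]
          intro y hy hyF
          have hyr := (hM₃ y).1 ⟨F, hF, hyF⟩
          rw [hE, List.mem_toFinset] at hy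
          have : (x :: t.map Prod.fst ++ r.map Prod.fst).Nodup := hnd'
          exact (List.nodup_append.1 this).2.2 _ hy _ hyr rfl
        have hcard : E.card = k := by
          rw [hE, List.toFinset_card_of_nodup]
          · simp only [List.length_cons, List.length_map]
            omega
          · have : (x :: t.map Prod.fst ++ r.map Prod.fst).Nodup := hnd'
            exact (List.nodup_append.1 this).1
        have hEe : E ∈ H.edges := by
          refine hp.1 E hcard (by simp [hE]) ?_
          intro y hy
          have hy' : y = x ∨ y ∈ t.map Prod.fst := by
            simpa only [hE, List.coe_toFinset, Set.mem_ofPred_eq, List.mem_cons] using hy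
          rcases hy' with rfl | hy'
          · simp
          · exact List.mem_cons_of_mem _ (hperm'.mem_iff.2 (List.mem_append_left _ hy'))
        refine ⟨insert E M, ?_, ?_, ?_⟩
        · intro F hF
          rcases Finset.mem_insert.1 hF with rfl | hF
          exacts [hEe, hM₁ F hF]
        · intro F hF G hG hne
          rcases Finset.mem_insert.1 hF with rfl | hF <;>
            rcases Finset.mem_insert.1 hG with rfl | hG
          · exact absurd rfl hne
          · exact hdisj G hG
          · exact (hdisj F hF).symm
          · exact hM₂ F hF G hG hne
        · intro y
          rw [List.map_cons, (hperm'.cons x).mem_iff]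
          simp only [Finset.exists_mem_insert, hM₃, hE, List.mem_toFinset, List.mem_cons,
            List.mem_append]
          tauto

/-- When the first vertex of `E` is removed, all of `E` is still present; since `E` is an edge, that
vertex cannot be isolating. -/
theorem Peels.exists_first {H : KHypergraph k V} {L : List (V × Bool)} (hp : H.Peels L)
    {E : Finset V} (hE : E ∈ H.edges) (hEL : ∀ x ∈ E, x ∈ L.map Prod.fst) {m : ℕ}
    (h : ∃ e ∈ L.take m, e.1 ∈ E) : ∃ e ∈ L.take m, e.1 ∈ E ∧ e.2 = true := by
  induction L generalizing m with
  | nil => simp at h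
  | cons a L ih =>
    cases m with
    | zero => simp at h
    | succ m =>
      by_cases ha : a.1 ∈ E
      · refine ⟨a, by simp, ha, ?_⟩
        by_contra hf
        rw [Bool.not_eq_true] at hf
        have := hp.1
        simp only [RemovableAs, hf] at this
        exact this E (H.card_eq E hE) ha hEL hE
      · have hEL' : ∀ x ∈ E, x ∈ L.map Prod.fst := by
          intro x hx
          have := hEL x hx
          rw [List.map_cons, List.mem_cons] at this
          exact this.resolve_left fun h => ha (h ▸ hx)
        obtain ⟨e, he, heE⟩ := h
        rw [List.take_succ_cons, List.mem_cons] at he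
        have he' := he.resolve_left fun h => ha (h ▸ heE)
        obtain ⟨e', h₁, h₂⟩ := ih hp.2 hEL' ⟨e, he', heE⟩
        exact ⟨e', by simp [h₁], h₂⟩

theorem IsPeeling.balanced_of_matching {H : KHypergraph k V} {L : List (V × Bool)}
    (hL : H.IsPeeling L) (hM : H.HasPerfectMatching) : k ∣ L.length ∧ Balanced k 0 L := by
  classical
  obtain ⟨M, hM₁, hM₂, hM₃⟩ := hM
  constructor
  · have h₁ : (L.map Prod.fst).toFinset = M.biUnion fun E => E := by
      ext x
      simp only [List.mem_toFinset, hL.mem x, Finset.mem_biUnion, true_iff]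
      exact hM₃ x
    have h₂ : (L.map Prod.fst).toFinset.card = L.length := by
      rw [List.toFinset_card_of_nodup hL.nodup, List.length_map]
    rw [← h₂, h₁, Finset.card_biUnion (fun E hE F hF hne => hM₂ E hE F hF hne),
      Finset.sum_congr rfl fun E hE => H.card_eq E (hM₁ E hE)]
    simp
  · rw [balanced_iff]
    intro m
    choose f hfM hf using hM₃
    have hnd : (L.take m).Nodup := (List.Nodup.of_map _ hL.nodup).sublist (List.take_sublist _ _)
    -- The prefix sum is grouped by the matching edge containing each vertex; each group is shown to
    -- have a nonnegative sum.
    rw [zero_add, ← List.sum_toFinset _ hnd,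
      ← Finset.sum_fiberwise_of_maps_to (t := M) (g := fun e => f e.1) (fun e _ => hfM e.1)]
    refine Finset.sum_nonneg fun E hE => ?_
    set F := (L.take m).toFinset.filter fun e => f e.1 = E with hF
    rcases F.eq_empty_or_nonempty with h0 | ⟨e, he⟩
    · simp [h0]
    · have hmem : ∀ e ∈ F, e ∈ L.take m ∧ e.1 ∈ E := by
        intro e he
        rw [hF, Finset.mem_filter, List.mem_toFinset] at he
        exact ⟨he.1, he.2 ▸ hf e.1⟩
      obtain ⟨e₀, h₁, h₂, h₃⟩ := hL.peels.exists_first (hM₁ E hE) (fun x _ => hL.mem x)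
        ⟨e, hmem e he⟩
      have he₀ : e₀ ∈ F := by
        rw [hF, Finset.mem_filter, List.mem_toFinset]
        refine ⟨h₁, ?_⟩
        by_contra hne
        exact Finset.disjoint_left.1 (hM₂ _ (hfM e₀.1) E hE hne) (hf e₀.1) h₂
      have hcard : F.card ≤ k := by
        rw [← H.card_eq E (hM₁ E hE)]
        refine Finset.card_le_card_of_injOn Prod.fst (fun e he => (hmem e he).2) ?_
        intro e he e' he' hee
        exact List.inj_on_of_nodup_map hL.nodup (List.mem_of_mem_take (hmem e he).1)
          (List.mem_of_mem_take (hmem e' he').1) hee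
      have hpos : 1 ≤ F.card := Finset.card_pos.2 ⟨e₀, he₀⟩
      -- Besides `e₀`, of weight `k - 1`, the group has at most `k - 1` members, each of weight at
      -- least `-1`.
      have hrest : ∑ e ∈ F.erase e₀, (-1 : ℤ) ≤ ∑ e ∈ F.erase e₀, weight k e.2 := by
        refine Finset.sum_le_sum fun e _ => ?_
        unfold weight
        split <;> omega
      rw [← Finset.add_sum_erase F _ he₀, h₃]
      rw [Finset.sum_const, Finset.card_erase_of_mem he₀, nsmul_eq_mul, Nat.cast_sub hpos] at hrest
      simp only [weight, if_true]
      push_cast at hrest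
      have : (F.card : ℤ) ≤ k := by exact_mod_cast hcard
      unfold weight at hrest
      linarith

/-- This holds for every admissible designation of vertices that are both dominating and isolating,
and so also for the order found by the algorithm. -/
theorem IsPeeling.hasPerfectMatching_iff {H : KHypergraph k V} {L : List (V × Bool)}
    (hL : H.IsPeeling L) : H.HasPerfectMatching ↔ k ∣ L.length ∧ Balanced k 0 L := by
  refine ⟨hL.balanced_of_matching, ?_⟩
  rintro ⟨⟨m, hm⟩, hb⟩
  obtain ⟨M, h₁, h₂, h₃⟩ := exists_matching_of_balanced m hm hL.peels hL.nodup hb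
  exact ⟨M, h₁, h₂, fun x => (h₃ x).2 (hL.mem x)⟩

theorem mem_drop_finRange {n : ℕ} {i j : Fin n} : i ∈ (List.finRange n).drop j ↔ j ≤ i := by
  rw [List.mem_iff_getElem]
  constructor
  · rintro ⟨m, hm, rfl⟩
    simp [Fin.le_def]
  · intro h
    have := Fin.le_def.1 h
    exact ⟨i - j, by simp; omega, by simp [Fin.ext_iff]; omega⟩

/-- The first `n - j` entries of the reversed order are the vertices of index at least `j`. -/
theorem IsEliminationOrder.sum_weight_take {H : KHypergraph k V} {n : ℕ} {v : Fin n ≃ V}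
    (h : H.IsEliminationOrder v) (j : Fin n) :
    (((H.peelingOf v).take (n - j)).map fun e => weight k e.2).sum = H.balance v j := by
  classical
  have hiso : ∀ i, (H.IsolatingAt v i ∧ ¬ H.DominatingAt v i) ↔ ¬ H.DominatingAt v i :=
    fun i => ⟨fun h => h.2, fun hd => ⟨(h i).resolve_left hd, hd⟩⟩
  have htake : (H.peelingOf v).take (n - j) =
      ((List.finRange n).drop j).reverse.map fun i => (v i, decide (H.DominatingAt v i)) := by
    rw [peelingOf, ← List.map_take, List.take_reverse]
    congr 3
    simp
    omega
  have hnd : ((List.finRange n).drop j).Nodup :=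
    (List.nodup_finRange n).sublist (List.drop_sublist _ _)
  have hset : ((List.finRange n).drop j).toFinset = Finset.univ.filter fun i => j ≤ i := by
    ext i
    simp [mem_drop_finRange]
  rw [htake, List.map_map, List.map_reverse, List.sum_reverse, ← List.sum_toFinset _ hnd, hset,
    balance, numDominating, numIsolating]
  simp only [hiso, ← Finset.filter_filter, Function.comp_apply, weight, decide_eq_true_eq]
  rw [Finset.sum_ite, Finset.sum_const, Finset.sum_const]
  simp only [nsmul_eq_mul]
  ring

theorem IsEliminationOrder.hasPerfectMatching_iff {H : KHypergraph k V} {n : ℕ} {v : Fin n ≃ V}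
    (h : H.IsEliminationOrder v) :
    H.HasPerfectMatching ↔ k ∣ n ∧ ∀ j : Fin n, 0 ≤ H.balance v j := by
  rw [h.isPeeling.hasPerfectMatching_iff]
  have hlen : (H.peelingOf v).length = n := by simp [peelingOf]
  rw [hlen, balanced_iff]
  refine and_congr_right fun _ => ⟨fun hm j => ?_, fun hj m => ?_⟩
  · rw [← h.sum_weight_take j]
    simpa using hm (n - j)
  · rcases Nat.eq_zero_or_pos m with rfl | hm
    · simp
    rcases Nat.eq_zero_or_pos n with rfl | hn
    · simp [List.length_eq_zero_iff.1 hlen]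
    rcases Nat.lt_or_ge n m with hlt | hge
    -- Prefixes longer than the list have the full sum, which is the case `j = 0`.
    · have := hj ⟨0, hn⟩
      rw [← h.sum_weight_take] at this
      rw [List.take_of_length_le (by rw [hlen]; simp)] at this
      rw [List.take_of_length_le (by omega)]
      simpa using this
    · have := hj ⟨n - m, by omega⟩
      rw [← h.sum_weight_take, show n - (n - m) = m by omega] at this
      simpa using this

end Matching

end KHypergraph

/-! ### Elementary stack programs -/

namespace StackProg

open StackMemory

section Basic

variable {K S : Type} [DecidableEq K] [StackMemory K S]

theorem Run.cast {p : StackProg K} {s s' s'' : S} {T T' : ℕ} (h : Run p s T s') (hs : s' = s'')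
    (hT : T ≤ T') : Run p s T' s'' :=
  hs ▸ h.mono hT

theorem Run.of_eq {p : StackProg K} {s₀ s s' : S} {T : ℕ} (h : Run p s T s') (hs : s₀ = s) :
    Run p s₀ T s' :=
  hs ▸ h

/-- Repeat a program a fixed number of times. -/
def rep : ℕ → StackProg K → StackProg K
  | 0, _ => skip
  | i + 1, p => seq p (rep i p)

/-- Empty a stack. -/
def drop (a : K) : StackProg K := loop a fun _ => skip

/-- Move the content of a stack onto another one, in reverse order. -/
def move (a b : K) : StackProg K := loop a fun x => push b x

/-- Move the content of a stack `a` onto `b`, and its image under `f` onto `c`, both in reverse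
order. -/
def fork (a b c : K) (f : Bool → Bool) : StackProg K :=
  loop a fun x => seq (push b x) (push c (f x))

theorem run_drop (a : K) (s : S) : Run (drop a) s (2 * (get s a).length + 1) (set a [] s) := by
  generalize hl : get s a = l
  induction l generalizing s with
  | nil => exact (Run.loop_nil hl).mono (by simp)
  | cons x l ih =>
    refine (Run.loop_cons hl (Run.skip _) (ih (set a l s) (by simp [get_set]))).cast ?_ ?_
    · exact get_injective (by simp [get_set])
    · rw [List.length_cons]
      omega

theorem run_move {a b : K} (hab : a ≠ b) (s : S) : Run (move a b) s (2 * (get s a).length + 1)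
    (set b ((get s a).reverse ++ get s b) (set a [] s)) := by
  generalize hl : get s a = l
  induction l generalizing s with
  | nil =>
    refine (Run.loop_nil hl).cast (get_injective ?_) (by simp)
    simp [get_set, Function.update_of_ne hab.symm]
  | cons x l ih =>
    refine (Run.loop_cons hl (Run.push _ _ _) (ih _ ?_)).cast (get_injective ?_) ?_
    · simp [get_set, Function.update_of_ne hab]
    · simp only [get_set, Function.update_of_ne hab.symm, Function.update_self,
        List.reverse_cons, List.append_assoc, List.singleton_append]
      rw [Function.update_comm hab, Function.update_idem, Function.update_comm hab.symm,
        Function.update_idem]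
    · rw [List.length_cons]
      omega

theorem run_fork {a b c : K} (hab : a ≠ b) (hac : a ≠ c) (hbc : b ≠ c) (f : Bool → Bool) (s : S) :
    Run (fork a b c f) s (3 * (get s a).length + 1)
      (set c (((get s a).map f).reverse ++ get s c)
        (set b ((get s a).reverse ++ get s b) (set a [] s))) := by
  generalize hl : get s a = l
  induction l generalizing s with
  | nil =>
    refine (Run.loop_nil hl).cast (get_injective (funext fun j => ?_)) (by simp)
    simp only [get_set, Function.update_apply]
    by_cases hc : j = c <;> by_cases hb : j = b <;> simp_all
  | cons x l ih =>
    refine (Run.loop_cons hl (Run.seq (Run.push _ _ _) (Run.push _ _ _)) (ih _ ?_)).cast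
      (get_injective ?_) ?_
    · simp [get_set, Function.update_of_ne hab, Function.update_of_ne hac]
    · funext j
      simp only [get_set, Function.update_apply]
      by_cases hc : j = c <;> by_cases hb : j = b <;> by_cases ha : j = a <;>
        simp_all
    · rw [List.length_cons]
      omega

end Basic

end StackProg

/-! ### Programs acting on blocks of bits -/

namespace KHypergraph

open StackProg StackMemory

/-- The stacks of the machine deciding orderability: `w` holds the input and later the adjacency
tensor, `u` the characteristic list of the remaining vertices, `n` and `c` are counters, `q` holds
the balance and `f` tells whether it became negative. -/
inductive Stack : Type
  | w | u | n | c | q | f | a | o | r | l | t | s | d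
  deriving DecidableEq

instance : Fintype Stack where
  elems := {.w, .u, .n, .c, .q, .f, .a, .o, .r, .l, .t, .s, .d}
  complete x := by cases x <;> decide

/-- A content of the stacks. -/
@[ext]
structure Mem : Type where
  w : List Bool
  u : List Bool
  n : List Bool
  c : List Bool
  q : List Bool
  f : List Bool
  a : List Bool
  o : List Bool
  r : List Bool
  l : List Bool
  t : List Bool
  s : List Bool
  d : List Bool

/-- The content of a stack. -/
def Mem.get (m : Mem) : Stack → List Bool
  | .w => m.w
  | .u => m.u
  | .n => m.n
  | .c => m.c
  | .q => m.q
  | .f => m.f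
  | .a => m.a
  | .o => m.o
  | .r => m.r
  | .l => m.l
  | .t => m.t
  | .s => m.s
  | .d => m.d

/-- Replace the content of a stack. -/
def Mem.set (k : Stack) (x : List Bool) (m : Mem) : Mem :=
  match k with
  | .w => { m with w := x }
  | .u => { m with u := x }
  | .n => { m with n := x }
  | .c => { m with c := x }
  | .q => { m with q := x }
  | .f => { m with f := x }
  | .a => { m with a := x }
  | .o => { m with o := x }
  | .r => { m with r := x }
  | .l => { m with l := x }
  | .t => { m with t := x }
  | .s => { m with s := x }
  | .d => { m with d := x }

instance : StackMemory Stack Mem where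
  get := Mem.get
  set := Mem.set
  get_set k x m := by
    funext j
    cases k <;> cases j <;> rfl
  get_injective m m' h := by
    ext1
    exacts [congrFun h .w, congrFun h .u, congrFun h .n, congrFun h .c, congrFun h .q,
      congrFun h .f, congrFun h .a, congrFun h .o, congrFun h .r, congrFun h .l, congrFun h .t,
      congrFun h .s, congrFun h .d]

section Programs

/-- With a block split as `l.reverse ++ x :: r`, append to `o` a copy of it with the entry at `x`
removed, or a zero block if `x` is `false`. -/
def rowProg (x : Bool) : StackProg Stack :=
  seq (move .l .t) <| seq (fork .t .l .o (· && x)) <| seq (push .o false) <|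
    seq (fork .r .t .o (· && x)) <| seq (move .t .r) (push .l x)

theorem run_rowProg (m : Mem) (x : Bool) (R L O : List Bool) :
    Run (rowProg x) { m with r := R, l := L, t := [], o := O } (5 * (L.length + R.length) + 6)
      { m with r := R, l := x :: L, t := [],
               o := ((L.reverse ++ false :: R).map (· && x)).reverse ++ O } := by
  refine ((run_move (by decide) _).seq <| (run_fork (by decide) (by decide) (by decide) _ _).seq <|
    (Run.push _ _ _).seq <| (run_fork (by decide) (by decide) (by decide) _ _).seq <|
    (run_move (by decide) _).seq (Run.push _ _ _)).cast ?_ ?_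
  · simp [StackMemory.get, StackMemory.set, Mem.get, Mem.set]
  · simp [StackMemory.get, StackMemory.set, Mem.get, Mem.set]
    omega

/-- The entries produced by `rowProg` for all `x` in a block `P ++ R` that come from `R`. -/
def rows : List Bool → List Bool → List Bool
  | _, [] => []
  | P, x :: R => (P ++ false :: R).map (· && x) ++ rows (P ++ [x]) R

theorem length_rows (P R : List Bool) :
    (rows P R).length = R.length * (P.length + R.length) := by
  induction R generalizing P with
  | nil => simp [rows]
  | cons x R ih =>
    simp only [rows, List.length_append, List.length_map, ih, List.length_cons, List.length_nil]
    ring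

/-- The stack `l` holds the treated entries in reverse, so `L.reverse` is the prefix argument of
`rows`; the output on `o` is reversed as well. -/
theorem run_rows (m : Mem) (R L O : List Bool) :
    Run (loop .r rowProg) { m with r := R, l := L, t := [], o := O }
      (R.length * (5 * (L.length + R.length) + 7) + 1)
      { m with r := [], l := R.reverse ++ L, t := [], o := (rows L.reverse R).reverse ++ O } := by
  induction R generalizing L O with
  | nil => exact (Run.loop_nil rfl).mono (by simp)
  | cons x R ih =>
    refine (Run.loop_cons rfl (run_rowProg m x R L O) (ih _ _)).cast ?_ ?_
    · simp [rows]
    · simp only [List.length_cons]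
      ring_nf
      omega

/-- Move a block of bits from `a` to `r`; its length is given by the counter `n`. -/
def takeBlock : StackProg Stack :=
  seq (loop .n fun _ => seq (pop .a skip fun x => push .s x) (push .t true)) <|
    seq (move .t .n) (move .s .r)

theorem run_takeBlock_loop (m : Mem) (B A S T : List Bool) :
    Run (loop .n fun _ => seq (pop .a skip fun x => push .s x) (push .t true))
      { m with n := List.replicate B.length true, a := B ++ A, s := S, t := T }
      (4 * B.length + 1)
      { m with n := [], a := A, s := B.reverse ++ S,
               t := List.replicate B.length true ++ T } := by
  induction B generalizing S T with
  | nil => exact Run.loop_nil rfl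
  | cons x B ih =>
    refine (Run.loop_cons rfl ((Run.pop_cons rfl (Run.push _ _ _)).seq (Run.push _ _ _))
      (ih (x :: S) (true :: T))).cast ?_ ?_
    · rw [List.length_cons, List.replicate_succ']
      simp
    · simp only [List.length_cons]
      omega

theorem run_takeBlock (m : Mem) (B A : List Bool) :
    Run takeBlock { m with n := List.replicate B.length true, a := B ++ A, s := [], t := [],
                           r := [] }
      (8 * B.length + 3)
      { m with n := List.replicate B.length true, a := A, s := [], t := [], r := B } := by
  refine ((run_takeBlock_loop { m with r := [] } B A [] []).seq <|
    (run_move (by decide) _).seq (run_move (by decide) _)).cast ?_ ?_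
  · simp [StackMemory.get, StackMemory.set, Mem.get, Mem.set]
  · simp [StackMemory.get, StackMemory.set, Mem.get, Mem.set]
    omega

/-- Replace each block `B` of the list on `a` by one block for each of its entries: the block `B`
with this entry removed, or a zero block if the entry is `false`. -/
def expandProg : StackProg Stack :=
  seq (loop .a fun x => seq (push .a x) <| seq takeBlock <| seq (loop .r rowProg) (drop .l))
    (move .o .a)

theorem run_expandProg_loop (m : Mem) (n : ℕ) (hn : 0 < n) (Bs : List (List Bool))
    (hB : ∀ B ∈ Bs, B.length = n) (O : List Bool) :
    Run (loop .a fun x => seq (push .a x) <| seq takeBlock <| seq (loop .r rowProg) (drop .l))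
      { m with n := List.replicate n true, a := Bs.flatten, o := O, r := [], l := [], t := [],
               s := [] }
      (Bs.length * (5 * n ^ 2 + 17 * n + 7) + 1)
      { m with n := List.replicate n true, a := [], o := (Bs.flatMap (rows [])).reverse ++ O,
               r := [], l := [], t := [], s := [] } := by
  induction Bs generalizing O with
  | nil => exact (Run.loop_nil rfl).mono (by simp)
  | cons B Bs ih =>
    obtain rfl := hB B (by simp)
    -- The loop pops a bit only to learn whether another block follows, and pushes it back. This
    -- needs nonempty blocks, hence `0 < n`.
    obtain ⟨x, B', rfl⟩ := List.exists_cons_of_length_pos hn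
    refine (Run.loop_cons rfl ((Run.push _ _ _).seq <|
      (run_takeBlock { m with o := O, l := [] } (x :: B') Bs.flatten).seq <|
      (run_rows { m with n := List.replicate (x :: B').length true, a := Bs.flatten, s := [] }
        (x :: B') [] O).seq (run_drop _ _))
      (ih (fun B hB' => hB B (List.mem_cons_of_mem _ hB')) _)).cast ?_ ?_
    · simp
    · simp only [StackMemory.get, Mem.get, List.length_append, List.length_reverse,
        List.length_nil, List.length_cons]
      ring_nf
      omega

theorem run_expandProg (m : Mem) (n : ℕ) (hn : 0 < n) (Bs : List (List Bool))
    (hB : ∀ B ∈ Bs, B.length = n) :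
    Run expandProg
      { m with n := List.replicate n true, a := Bs.flatten, o := [], r := [], l := [], t := [],
               s := [] }
      (Bs.length * (7 * n ^ 2 + 17 * n + 7) + 2)
      { m with n := List.replicate n true, a := Bs.flatMap (rows []), o := [],
               r := [], l := [], t := [], s := [] } := by
  have hlen : (Bs.flatMap (rows [])).length = Bs.length * n ^ 2 := by
    rw [List.length_flatMap, List.map_congr_left (g := fun _ => n ^ 2)]
    · simp
    · intro B h
      simp [length_rows, hB B h, sq]
  refine ((run_expandProg_loop m n hn Bs hB []).seq (run_move (by decide) _)).cast ?_ ?_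
  · simp [StackMemory.get, StackMemory.set, Mem.get, Mem.set]
  · simp only [StackMemory.get, Mem.get, List.append_nil, List.length_reverse, hlen]
    ring_nf
    omega

/-- Replace each block of the list on `a` by the conjunction of its entries. -/
def reduceProg : StackProg Stack :=
  seq (loop .a fun x => seq (push .a x) <|
    seq (seq (loop .n fun _ => seq (pop .a skip fun y => cond y skip (push .l true))
      (push .t true)) (move .t .n)) <|
    pop .l (push .o true) fun _ => seq (push .o false) (drop .l))
    (move .o .a)

/-- Each `false` leaves a mark on `l`, so the conjunction of the block holds exactly if no mark was
added. The used-up counter is kept on `t`. -/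
theorem run_reduceProg_block (m : Mem) (B A L T : List Bool) :
    Run (loop .n fun _ => seq (pop .a skip fun y => cond y skip (push .l true))
      (push .t true))
      { m with n := List.replicate B.length true, a := B ++ A, l := L, t := T }
      (4 * B.length + 1)
      { m with n := [], a := A, l := List.replicate (B.count false) true ++ L,
               t := List.replicate B.length true ++ T } := by
  induction B generalizing L T with
  | nil => exact Run.loop_nil rfl
  | cons x B ih =>
    cases x with
    | true =>
      refine Run.cast (Run.loop_cons rfl (Run.seq (Run.pop_cons rfl (Run.skip _))
        (Run.push _ _ _)) (ih L (true :: T))) ?_ ?_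
      · rw [List.length_cons, List.replicate_succ']
        simp
      · simp only [List.length_cons]
        omega
    | false =>
      refine Run.cast (Run.loop_cons rfl (Run.seq (Run.pop_cons rfl (Run.push _ _ _))
        (Run.push _ _ _)) (ih (true :: L) (true :: T))) ?_ ?_
      · rw [List.length_cons, List.count_cons_self, List.replicate_succ', List.replicate_succ']
        simp
      · simp only [List.length_cons]
        omega

theorem run_reduceProg_count (m : Mem) (B A : List Bool) :
    Run (seq (loop .n fun _ => seq (pop .a skip fun y => cond y skip (push .l true))
      (push .t true)) (move .t .n))
      { m with n := List.replicate B.length true, a := B ++ A, l := [], t := [] }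
      (6 * B.length + 2)
      { m with n := List.replicate B.length true, a := A,
               l := List.replicate (B.count false) true, t := [] } := by
  refine Run.cast (Run.seq (run_reduceProg_block m B A [] []) (run_move (by decide) _)) ?_ ?_
  · simp [StackMemory.get, StackMemory.set, Mem.get, Mem.set]
  · simp [StackMemory.get, Mem.get]
    omega

theorem run_reduceProg_output (m : Mem) (i : ℕ) (O : List Bool) :
    Run (pop .l (push .o true) fun _ => seq (push .o false) (drop .l))
      { m with l := List.replicate i true, o := O } (2 * i + 3)
      { m with l := [], o := decide (i = 0) :: O } := by
  cases i with
  | zero => exact (Run.pop_nil rfl (Run.push _ _ _)).mono (by omega)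
  | succ i =>
    refine (Run.pop_cons rfl ((Run.push _ _ _).seq (run_drop _ _))).cast ?_ ?_
    · simp [StackMemory.get, StackMemory.set, Mem.get, Mem.set]
    · simp [StackMemory.get, StackMemory.set, Mem.get, Mem.set]
      omega

theorem run_reduceProg_loop (m : Mem) (n : ℕ) (hn : 0 < n) (Bs : List (List Bool))
    (hB : ∀ B ∈ Bs, B.length = n) (O : List Bool) :
    Run (loop .a fun x => seq (push .a x) <|
      seq (seq (loop .n fun _ => seq (pop .a skip fun y => cond y skip (push .l true))
        (push .t true)) (move .t .n)) <|
      pop .l (push .o true) fun _ => seq (push .o false) (drop .l))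
      { m with n := List.replicate n true, a := Bs.flatten, o := O, l := [], t := [] }
      (Bs.length * (8 * n + 7) + 1)
      { m with n := List.replicate n true, a := [], o := (Bs.map (·.all id)).reverse ++ O,
               l := [], t := [] } := by
  induction Bs generalizing O with
  | nil => exact (Run.loop_nil rfl).mono (by simp)
  | cons B Bs ih =>
    obtain rfl := hB B (by simp)
    obtain ⟨x, B', rfl⟩ := List.exists_cons_of_length_pos hn
    have hall : decide ((x :: B').count false = 0) = (x :: B').all id := by
      rw [Bool.eq_iff_iff, decide_eq_true_eq, List.count_eq_zero, List.all_eq_true]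
      constructor
      · intro h y hy
        cases y
        exacts [absurd hy h, rfl]
      · intro h hf
        simpa using h _ hf
    have hcount : (x :: B').count false ≤ (x :: B').length := List.count_le_length
    refine Run.cast (Run.loop_cons rfl (Run.seq (Run.push _ _ _) <| Run.seq
      (run_reduceProg_count { m with o := O } (x :: B') Bs.flatten)
      (run_reduceProg_output { m with n := List.replicate (x :: B').length true,
                                      a := Bs.flatten, t := [] } ((x :: B').count false) O))
      (ih (fun B hB' => hB B (List.mem_cons_of_mem _ hB')) _)) ?_ ?_
    · simp [hall]
    · simp only [List.length_cons] at hcount ⊢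
      ring_nf
      omega

theorem run_reduceProg (m : Mem) (n : ℕ) (hn : 0 < n) (Bs : List (List Bool))
    (hB : ∀ B ∈ Bs, B.length = n) :
    Run reduceProg
      { m with n := List.replicate n true, a := Bs.flatten, o := [], l := [], t := [] }
      (Bs.length * (8 * n + 9) + 2)
      { m with n := List.replicate n true, a := Bs.map (·.all id), o := [], l := [], t := [] } := by
  refine Run.cast (Run.seq (run_reduceProg_loop m n hn Bs hB []) (run_move (by decide) _)) ?_ ?_
  · simp [StackMemory.get, StackMemory.set, Mem.get, Mem.set]
  · simp [StackMemory.get, Mem.get]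
    ring_nf
    omega

/-- Replace each bit `x` on `a` by `x → (y = b)`, where `y` is the corresponding bit on `w`. -/
def compareProg (b : Bool) : StackProg Stack :=
  seq (loop .a fun x => pop .w skip fun y => seq (push .t y) (push .o (!x || (y == b)))) <|
    seq (move .t .w) (move .o .a)

theorem run_compareProg_loop (m : Mem) (b : Bool) (P : List (Bool × Bool)) (T O : List Bool) :
    Run (loop .a fun x => pop .w skip fun y => seq (push .t y) (push .o (!x || (y == b))))
      { m with a := P.map Prod.fst, w := P.map Prod.snd, t := T, o := O } (4 * P.length + 1)
      { m with a := [], w := [], t := (P.map Prod.snd).reverse ++ T,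
               o := (P.map fun e => !e.1 || (e.2 == b)).reverse ++ O } := by
  induction P generalizing T O with
  | nil => exact Run.loop_nil rfl
  | cons e P ih =>
    refine Run.cast (Run.loop_cons rfl (Run.pop_cons rfl (Run.seq (Run.push _ _ _)
      (Run.push _ _ _))) (ih _ _)) ?_ ?_
    · simp [StackMemory.get, StackMemory.set, Mem.get, Mem.set]
    · simp only [List.length_cons]
      omega

theorem run_compareProg (m : Mem) (b : Bool) (P : List (Bool × Bool)) :
    Run (compareProg b) { m with a := P.map Prod.fst, w := P.map Prod.snd, t := [], o := [] }
      (8 * P.length + 3)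
      { m with a := P.map fun e => !e.1 || (e.2 == b), w := P.map Prod.snd, t := [], o := [] } := by
  refine Run.cast (Run.seq (run_compareProg_loop m b P [] []) (Run.seq (run_move (by decide) _)
    (run_move (by decide) _))) ?_ ?_
  · simp [StackMemory.get, StackMemory.set, Mem.get, Mem.set]
  · simp [StackMemory.get, StackMemory.set, Mem.get, Mem.set]
    omega

/-- The current vertex list, balance and failure count. -/
structure Tally : Type where
  u : List Bool
  q : ℕ
  f : ℕ

/-- Treat a vertex, given whether it is present, dominating, isolating. -/
def Tally.step (j : ℕ) (σ : Tally) (e : Bool × Bool × Bool) : Tally :=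
  if e.1 && (e.2.1 || e.2.2) then
    if e.2.1 then ⟨false :: σ.u, σ.q + j, σ.f⟩
    else if σ.q = 0 then ⟨false :: σ.u, σ.q, σ.f + 1⟩ else ⟨false :: σ.u, σ.q - 1, σ.f⟩
  else ⟨e.1 :: σ.u, σ.q, σ.f⟩

/-- Remove the vertices of the list on `r` that are found dominating or isolating according to the
lists on `d` and `s`, and update the balance; `j` is the edge size minus one. -/
def updateProg (j : ℕ) : StackProg Stack :=
  loop .r fun x => pop .d skip fun y => pop .s skip fun z =>
    cond (x && (y || z))
      (seq (push .u false) (cond y (rep j (push .q true)) (pop .q (push .f true) fun _ => skip)))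
      (push .u x)

theorem run_rep_push (m : Mem) (j i : ℕ) :
    Run (rep j (push .q true)) { m with q := List.replicate i true } (j + 1)
      { m with q := List.replicate (i + j) true } := by
  induction j generalizing i with
  | zero => exact Run.skip _
  | succ j ih =>
    refine Run.cast (Run.seq (Run.push _ _ _) (ih (i + 1))) ?_ ?_
    · rw [add_right_comm, add_assoc]
    · omega

theorem run_updateProg_step (m : Mem) (j : ℕ) (σ : Tally) (e : Bool × Bool × Bool) :
    Run (cond (e.1 && (e.2.1 || e.2.2))
      (seq (push .u false) (cond e.2.1 (rep j (push .q true))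
        (pop .q (push .f true) fun _ => skip)))
      (push .u e.1))
      { m with u := σ.u, q := List.replicate σ.q true, f := List.replicate σ.f true } (j + 3)
      { m with u := (σ.step j e).u, q := List.replicate (σ.step j e).q true,
               f := List.replicate (σ.step j e).f true } := by
  obtain ⟨x, y, z⟩ := e
  obtain ⟨u, q, f⟩ := σ
  by_cases h : x && (y || z)
  · simp only [Tally.step, h, cond_true, if_true]
    cases y with
    | true =>
      exact Run.cast (Run.seq (Run.push _ _ _)
        (run_rep_push { m with u := false :: u, f := List.replicate f true } j q)) rfl (by omega)
    | false =>
      cases q with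
      | zero =>
        exact Run.cast (Run.seq (Run.push _ _ _) (Run.pop_nil rfl (Run.push _ _ _))) rfl (by omega)
      | succ q =>
        exact Run.cast (Run.seq (Run.push _ _ _) (Run.pop_cons rfl (Run.skip _))) rfl (by omega)
  · simp only [Tally.step, Bool.not_eq_true] at h ⊢
    simp only [h, cond_false]
    exact Run.cast (Run.push _ _ _) rfl (by omega)

theorem run_updateProg (m : Mem) (j : ℕ) (σ : Tally) (P : List (Bool × Bool × Bool)) :
    Run (updateProg j)
      { m with r := P.map (·.1), d := P.map (·.2.1), s := P.map (·.2.2), u := σ.u,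
               q := List.replicate σ.q true, f := List.replicate σ.f true }
      (P.length * (j + 6) + 1)
      { m with r := [], d := [], s := [], u := (P.foldl (Tally.step j) σ).u,
               q := List.replicate (P.foldl (Tally.step j) σ).q true,
               f := List.replicate (P.foldl (Tally.step j) σ).f true } := by
  induction P generalizing σ with
  | nil => exact (Run.loop_nil rfl).mono (by simp)
  | cons e P ih =>
    refine Run.cast (Run.loop_cons rfl (Run.pop_cons rfl (Run.pop_cons rfl
      (run_updateProg_step { m with r := P.map (·.1), d := P.map (·.2.1), s := P.map (·.2.2) }
        j σ e))) (ih _)) ?_ ?_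
    · simp
    · simp only [List.length_cons]
      ring_nf
      omega

end Programs

end KHypergraph

/-! ### Tensors indexed by tuples -/

namespace KHypergraph

open StackProg StackMemory

section Tensors

/-- Extending at the right end also yields the lexicographic order. A tensor is thus a concatenation
of blocks of length `n`, one for each prefix, which is the form the block programs act on. -/
theorem tuples_succ_snoc (n j : ℕ) : tuples n (j + 1) =
    (tuples n j).flatMap fun t => (List.finRange n).map fun x => t ++ [x] := by
  induction j with
  | zero => simp [tuples, List.map_eq_flatMap]
  | succ j ih =>
    conv_lhs => rw [tuples, ih]
    conv_rhs => rw [tuples]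
    simp only [List.flatMap_assoc, List.map_flatMap, List.flatMap_map, List.map_map,
      Function.comp_def, List.cons_append]

theorem length_tuples (n j : ℕ) : (tuples n j).length = n ^ j := by
  induction j with
  | zero => rfl
  | succ j ih => simp [tuples, ih, List.length_flatMap, pow_succ']

theorem map_tuples_succ {n j : ℕ} (g : List (Fin n) → Bool) : (tuples n (j + 1)).map g =
    ((tuples n j).map fun t => (List.finRange n).map fun x => g (t ++ [x])).flatten := by
  rw [tuples_succ_snoc, List.map_flatMap, List.flatMap_def]
  simp [Function.comp_def]

/-- The entry for `x` and `y` is the conjunction of theirs, with the diagonal cleared. As the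
entries are distinct, clearing a position is the same as clearing a value. -/
theorem rows_map {α : Type*} [DecidableEq α] (φ : α → Bool) (P R : List α) (h : (P ++ R).Nodup) :
    rows (P.map φ) (R.map φ) =
      R.flatMap fun x => (P ++ R).map fun y => decide (y ≠ x) && φ y && φ x := by
  induction R generalizing P with
  | nil => rfl
  | cons x R ih =>
    have hx := List.nodup_middle.1 h
    rw [List.nodup_cons, List.mem_append, not_or] at hx
    have key : (P.map φ ++ false :: R.map φ).map (· && φ x) =
        (P ++ x :: R).map fun y => decide (y ≠ x) && φ y && φ x := by
      have h₁ : ∀ y ∈ P, (φ y && φ x) = (decide (y ≠ x) && φ y && φ x) := fun y hy => by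
        simp [show y ≠ x from fun h => hx.1.1 (h ▸ hy)]
      have h₂ : ∀ y ∈ R, (φ y && φ x) = (decide (y ≠ x) && φ y && φ x) := fun y hy => by
        simp [show y ≠ x from fun h => hx.1.2 (h ▸ hy)]
      rw [List.map_append, List.map_append, List.map_cons, List.map_cons, List.map_map,
        List.map_map]
      simp only [Function.comp_def]
      rw [List.map_congr_left h₁, List.map_congr_left h₂]
      simp
    have ih' := ih (P ++ [x]) (by simpa using h)
    rw [List.map_append, List.map_singleton] at ih'
    rw [List.map_cons, rows, ih', key, List.flatMap_cons]
    simp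

/-- The tuple consists of distinct vertices of the set given by `u`. -/
def valid {n : ℕ} (u : Fin n → Bool) (t : List (Fin n)) : Bool := decide t.Nodup && t.all u

/-- Validity of a longer tuple is determined by two entries in the block of `t` and by `y ≠ x`. This
is why the tensor can be grown block by block without knowing `t`. -/
theorem valid_snoc_snoc {n : ℕ} (u : Fin n → Bool) (t : List (Fin n)) (x y : Fin n) :
    valid u (t ++ [x] ++ [y]) =
      (decide (y ≠ x) && valid u (t ++ [y]) && valid u (t ++ [x])) := by
  rw [Bool.eq_iff_iff]
  simp only [valid, List.nodup_append, Bool.and_eq_true, decide_eq_true_eq, List.all_append,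
    List.mem_append, List.mem_singleton, List.all_cons, List.all_nil, Bool.and_true,
    List.nodup_singleton]
  constructor
  · rintro ⟨⟨⟨h₁, -, h₂⟩, -, h₃⟩, ⟨h₄, h₅⟩, h₆⟩
    exact ⟨⟨fun h => h₃ x (Or.inr rfl) y rfl h.symm, ⟨h₁, trivial, fun a ha => h₃ a (Or.inl ha)⟩,
      h₄, h₆⟩, ⟨h₁, trivial, h₂⟩, h₄, h₅⟩
  · rintro ⟨⟨h₀, ⟨h₁, -, h₃⟩, h₄, h₆⟩, ⟨-, -, h₂⟩, -, h₅⟩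
    refine ⟨⟨⟨h₁, trivial, h₂⟩, trivial, ?_⟩, ⟨h₄, h₅⟩, h₆⟩
    rintro a (ha | rfl) b rfl
    exacts [h₃ a ha b rfl, fun h => h₀ h.symm]

/-- `g` holds for all extensions of a tuple by `j` entries. -/
def allExtensions {n : ℕ} (g : List (Fin n) → Bool) : ℕ → List (Fin n) → Bool
  | 0 => g
  | j + 1 => allExtensions (fun t => (List.finRange n).all fun x => g (t ++ [x])) j

theorem allExtensions_eq_true {n j : ℕ} {g : List (Fin n) → Bool} {t : List (Fin n)} :
    allExtensions g j t = true ↔ ∀ t', t'.length = j → g (t ++ t') = true := by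
  induction j generalizing g t with
  | zero => simp [allExtensions]
  | succ j ih =>
    rw [allExtensions, ih]
    simp only [List.all_eq_true, List.mem_finRange, true_imp_iff, List.append_assoc]
    constructor
    · intro h t' ht'
      have hne : t' ≠ [] := by
        rintro rfl
        simp at ht'
      -- The recursion quantifies over the last entry first, so the extension is split at its end.
      rw [← List.dropLast_append_getLast hne]
      exact h _ (by simp [ht']) _
    · intro h t' ht' x
      exact h _ (by simp [ht'])

end Tensors

/-! ### Running one round of removals -/

section Round

variable {n : ℕ}

/-- `rows_map` and `valid_snoc_snoc` identify the new blocks. The number `N` bounds both the block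
length `n` and the number `n ^ i` of blocks. -/
theorem run_expandProg_tuples (m : Mem) (hn : 0 < n) (u : Fin n → Bool) (i N : ℕ) (hnN : n ≤ N)
    (hi : n ^ i ≤ N) :
    Run expandProg
      { m with n := List.replicate n true, a := (tuples n (i + 1)).map (valid u), o := [],
               r := [], l := [], t := [], s := [] }
      (N * (7 * N ^ 2 + 17 * N + 7) + 2)
      { m with n := List.replicate n true, a := (tuples n (i + 2)).map (valid u), o := [],
               r := [], l := [], t := [], s := [] } := by
  have h := run_expandProg m n hn
    ((tuples n i).map fun t => (List.finRange n).map fun x => valid u (t ++ [x]))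
    (by simp +contextual)
  rw [← map_tuples_succ] at h
  refine Run.cast h ?_ ?_
  · congr 1
    rw [tuples_succ_snoc n (i + 1), tuples_succ_snoc n i]
    simp only [List.map_flatMap, List.flatMap_map, List.map_map, List.flatMap_assoc]
    refine congrArg (fun F => List.flatMap F (tuples n i)) (funext fun t => ?_)
    have := rows_map (fun x => valid u (t ++ [x])) [] (List.finRange n)
      (by simpa using List.nodup_finRange n)
    rw [List.map_nil] at this
    rw [this]
    simp only [List.nil_append, Function.comp_def, valid_snoc_snoc]
  · rw [List.length_map, length_tuples]
    gcongr

theorem run_rep_expandProg (m : Mem) (hn : 0 < n) (u : Fin n → Bool) (i j N : ℕ) (hnN : n ≤ N)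
    (hj : n ^ (i + j) ≤ N) :
    Run (rep j expandProg)
      { m with n := List.replicate n true, a := (tuples n (i + 1)).map (valid u), o := [],
               r := [], l := [], t := [], s := [] }
      (j * (N * (7 * N ^ 2 + 17 * N + 7) + 2) + 1)
      { m with n := List.replicate n true, a := (tuples n (i + 1 + j)).map (valid u), o := [],
               r := [], l := [], t := [], s := [] } := by
  induction j generalizing i with
  | zero => exact (Run.skip _).mono (by simp)
  | succ j ih =>
    refine Run.cast (Run.seq (run_expandProg_tuples m hn u i N hnN
      ((Nat.pow_le_pow_right hn (by omega)).trans hj))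
      (ih (i + 1) (by rwa [show i + 1 + j = i + (j + 1) by omega]))) ?_ ?_
    · rw [show i + 1 + 1 + j = i + 1 + (j + 1) by omega]
    · ring_nf
      omega

theorem run_rep_reduceProg (m : Mem) (hn : 0 < n) (g : List (Fin n) → Bool) (i j N : ℕ)
    (hnN : n ≤ N) (hj : n ^ (i + j) ≤ N) :
    Run (rep j reduceProg)
      { m with n := List.replicate n true, a := (tuples n (i + j)).map g, o := [], l := [],
               t := [] }
      (j * (N * (8 * N + 9) + 2) + 1)
      { m with n := List.replicate n true, a := (tuples n i).map (allExtensions g j), o := [],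
               l := [], t := [] } := by
  induction j generalizing g with
  | zero => exact (Run.skip _).mono (by simp)
  | succ j ih =>
    have h := run_reduceProg m n hn
      ((tuples n (i + j)).map fun t => (List.finRange n).map fun x => g (t ++ [x]))
      (by simp +contextual)
    rw [← map_tuples_succ, List.map_map, List.length_map, length_tuples] at h
    have hN : n ^ (i + j) ≤ N := (Nat.pow_le_pow_right hn (by omega)).trans hj
    refine Run.cast (Run.seq h (Run.of_eq
      (ih (fun t => (List.finRange n).all fun x => g (t ++ [x])) hN) ?_)) rfl ?_
    · congr 1
      simp [Function.comp_def, List.all_map]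
    · have : n ^ (i + j) * (8 * n + 9) + 2 ≤ N * (8 * N + 9) + 2 := by gcongr
      refine (Nat.add_le_add_right this _).trans ?_
      ring_nf
      omega

/-- Compute, for every vertex `x` of the set given on `u`, whether `x` is dominating (if `b`) or
isolating (if not) in this set; `j` is the edge size minus one. -/
def testProg (j : ℕ) (b : Bool) : StackProg Stack :=
  seq (seq (move .u .t) (fork .t .u .a id)) <| seq (rep j expandProg) <| seq (compareProg b) <|
    rep j reduceProg

/-- The outcome of `testProg`. -/
def testResult (u : Fin n → Bool) (h : List (Fin n) → Bool) (j : ℕ) (b : Bool) (x : Fin n) : Bool :=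
  allExtensions (fun t => !valid u t || (h t == b)) j [x]

/-- A bound on the running time of `testProg`. -/
def testTime (j N : ℕ) : ℕ :=
  5 * N + 2 + (j * (N * (7 * N ^ 2 + 17 * N + 7) + 2) + 1) + (8 * N + 3) +
    (j * (N * (8 * N + 9) + 2) + 1)

theorem run_testProg (m : Mem) (hn : 0 < n) (u : Fin n → Bool) (h : List (Fin n) → Bool)
    (j N : ℕ) (b : Bool) (hN : n ^ (j + 1) ≤ N) :
    Run (testProg j b)
      { m with n := List.replicate n true, u := (List.finRange n).map u,
               w := (tuples n (j + 1)).map h, a := [], o := [], r := [], l := [], t := [],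
               s := [] }
      (testTime j N)
      { m with n := List.replicate n true, u := (List.finRange n).map u,
               w := (tuples n (j + 1)).map h, a := (List.finRange n).map (testResult u h j b),
               o := [], r := [], l := [], t := [], s := [] } := by
  have hnN : n ≤ N := le_trans (by simpa using Nat.pow_le_pow_right hn (show 1 ≤ j + 1 by omega)) hN
  have hone : ∀ g : List (Fin n) → Bool,
      (tuples n 1).map g = (List.finRange n).map fun x => g [x] := fun g => by
    rw [map_tuples_succ]
    simp [tuples]
  -- A one-entry tuple is valid exactly if its vertex is present, so a copy of `u` is the tensor to
  -- start from.
  have h₁ : Run (seq (move .u .t) (fork .t .u .a id))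
      { m with n := List.replicate n true, u := (List.finRange n).map u,
               w := (tuples n (j + 1)).map h, a := [], o := [], r := [], l := [], t := [],
               s := [] }
      (5 * N + 2)
      { m with n := List.replicate n true, u := (List.finRange n).map u,
               w := (tuples n (j + 1)).map h, a := (tuples n (0 + 1)).map (valid u),
               o := [], r := [], l := [], t := [], s := [] } := by
    refine Run.cast (Run.seq (run_move (by decide) _)
      (run_fork (by decide) (by decide) (by decide) _ _)) ?_ ?_
    · rw [hone]
      simp [StackMemory.get, StackMemory.set, Mem.get, Mem.set, valid]
    · simp [StackMemory.get, StackMemory.set, Mem.get, Mem.set]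
      omega
  have h₂ := run_rep_expandProg { m with u := (List.finRange n).map u,
                                         w := (tuples n (j + 1)).map h } hn u 0 j N hnN
    ((Nat.pow_le_pow_right hn (by omega)).trans hN)
  rw [show 0 + 1 + j = j + 1 by omega] at h₂
  have h₃ := run_compareProg { m with n := List.replicate n true, u := (List.finRange n).map u,
                                      r := [], l := [], s := [] } b
    ((tuples n (j + 1)).map fun t => (valid u t, h t))
  rw [List.map_map, List.map_map, List.map_map, List.length_map, length_tuples] at h₃
  have h₄ := run_rep_reduceProg { m with u := (List.finRange n).map u, r := [], s := [],
                                         w := (tuples n (j + 1)).map h } hn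
    (fun t => !valid u t || (h t == b)) 1 j N hnN (by rwa [add_comm])
  rw [hone, add_comm 1 j] at h₄
  refine Run.cast (Run.seq h₁ (Run.seq h₂ (Run.seq h₃ h₄))) rfl ?_
  unfold testTime
  omega

/-- The state of the vertex `x` after a round. -/
def survives (u D I : Fin n → Bool) (x : Fin n) : Bool := u x && !(D x || I x)

/-- One round of removals. -/
def roundProg (j : ℕ) : StackProg Stack :=
  seq (testProg j true) <| seq (move .a .d) <| seq (testProg j false) <| seq (move .a .s) <|
    seq (move .u .r) (updateProg j)

/-- The effect of a round on the vertex list and the balance. -/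
def roundTally (j : ℕ) (u D I : Fin n → Bool) (q f : ℕ) : Tally :=
  ((List.finRange n).reverse.map fun x => (u x, D x, I x)).foldl (Tally.step j) ⟨[], q, f⟩

theorem run_roundProg (m : Mem) (hn : 0 < n) (u : Fin n → Bool) (h : List (Fin n) → Bool)
    (j N q f : ℕ) (hN : n ^ (j + 1) ≤ N) :
    Run (roundProg j)
      { m with n := List.replicate n true, u := (List.finRange n).map u,
               w := (tuples n (j + 1)).map h, a := [], o := [], r := [], l := [], t := [],
               s := [], d := [], q := List.replicate q true, f := List.replicate f true }
      (2 * testTime j N + N * (j + 12) + 4)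
      { m with n := List.replicate n true,
               u := (roundTally j u (testResult u h j true) (testResult u h j false) q f).u,
               w := (tuples n (j + 1)).map h, a := [], o := [], r := [], l := [], t := [],
               s := [], d := [],
               q := List.replicate
                (roundTally j u (testResult u h j true) (testResult u h j false) q f).q true,
               f := List.replicate
                (roundTally j u (testResult u h j true) (testResult u h j false) q f).f true } := by
  have hnN : n ≤ N := le_trans (by simpa using Nat.pow_le_pow_right hn (show 1 ≤ j + 1 by omega)) hN
  have h₁ := run_testProg { m with d := [], q := List.replicate q true, f := List.replicate f true }
    hn u h j N true hN
  have h₂ := run_testProg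
    { m with d := ((List.finRange n).map (testResult u h j true)).reverse ++ [],
             q := List.replicate q true, f := List.replicate f true }
    hn u h j N false hN
  -- The moves have reversed all three lists: vertices are treated in decreasing order, and pushing
  -- rebuilds `u` in increasing order.
  have h₃ := run_updateProg
    { m with n := List.replicate n true, w := (tuples n (j + 1)).map h, a := [], o := [], l := [],
             t := [] } j ⟨[], q, f⟩
    ((List.finRange n).reverse.map fun x =>
      (u x, testResult u h j true x, testResult u h j false x))
  refine Run.cast (Run.seq h₁ (Run.seq (run_move (by decide) _) (Run.seq h₂
    (Run.seq (run_move (by decide) _) (Run.seq (run_move (by decide) _)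
      (Run.of_eq h₃ ?_)))))) rfl ?_
  · simp [StackMemory.get, StackMemory.set, Mem.get, Mem.set, Function.comp_def]
  · simp [StackMemory.get, StackMemory.set, Mem.get, Mem.set]
    nlinarith

end Round

end KHypergraph

/-! ### Correctness of the rounds -/

namespace KHypergraph

open StackProg StackMemory

section Correctness

variable {n j : ℕ}

/-- The bits of the adjacency tensor. -/
noncomputable def edgeBit {k : ℕ} (H : KHypergraph k (Fin n)) (t : List (Fin n)) : Bool :=
  open Classical in decide (t.toFinset ∈ H.edges)

/-- The bit of a tuple depends only on its underlying set. The valid tuples beginning with `x`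
represent exactly the `(j + 1)`-sets through `x` inside the current vertex set. -/
theorem testResult_eq_true {H : KHypergraph (j + 1) (Fin n)} {u : Fin n → Bool} {b : Bool}
    {x : Fin n} :
    testResult u H.edgeBit j b x = true ↔ H.RemovableAs {y | u y = true} x b := by
  have key : testResult u H.edgeBit j b x = true ↔
      ∀ E : Finset (Fin n), E.card = j + 1 → x ∈ E → (E : Set (Fin n)) ⊆ {y | u y = true} →
        (E ∈ H.edges ↔ b = true) := by
    have hbit : ∀ t : List (Fin n), (H.edgeBit t == b) = true ↔
        (t.toFinset ∈ H.edges ↔ b = true) := by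
      intro t
      cases b <;> simp [edgeBit]
    simp only [testResult, allExtensions_eq_true, Bool.or_eq_true, Bool.not_eq_true', hbit,
      List.singleton_append]
    constructor
    · intro h E hE hx hu
      have hcons : (x :: (E.erase x).toList).toFinset = E := by
        rw [List.toFinset_cons, Finset.toList_toFinset, Finset.insert_erase hx]
      have hlen : (E.erase x).toList.length = j := by
        rw [Finset.length_toList, Finset.card_erase_of_mem hx]
        omega
      have := h (E.erase x).toList hlen
      rw [hcons] at this
      refine this.resolve_left ?_
      have hall : ∀ y, y = x ∨ (y ≠ x ∧ y ∈ E) → u y = true := by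
        rintro y (rfl | ⟨-, hy⟩)
        exacts [hu hx, hu hy]
      simp [valid, Finset.nodup_toList]
      exact ⟨hall x (Or.inl rfl), fun y h₁ h₂ => hall y (Or.inr ⟨h₁, h₂⟩)⟩
    · intro h t ht
      by_cases hv : valid u (x :: t) = false
      · exact Or.inl hv
      · right
        rw [Bool.not_eq_false, valid, Bool.and_eq_true, decide_eq_true_eq, List.all_eq_true] at hv
        refine h _ ?_ (by simp) ?_
        · rw [List.toFinset_card_of_nodup hv.1, List.length_cons, ht]
        · intro y hy
          exact hv.2 y (by simpa using hy)
  rw [key]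
  cases b with
  | true => simp [RemovableAs, DominatingIn]
  | false => simp [RemovableAs, IsolatingIn]

/-- The vertices removed in a round, designated. -/
def roundRemoved (u D I : Fin n → Bool) : List (Fin n × Bool) :=
  ((List.finRange n).reverse.filter fun x => u x && (D x || I x)).map fun x => (x, D x)

/-- Update a balance and a failure count for a designated vertex. -/
def chargeStep (j : ℕ) (s : ℕ × ℕ) (δ : Bool) : ℕ × ℕ :=
  if δ then (s.1 + j, s.2) else if s.1 = 0 then (s.1, s.2 + 1) else (s.1 - 1, s.2)

/-- Update a balance and a failure count for a list of designated vertices. -/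
def charge {α : Type*} (j : ℕ) (s : ℕ × ℕ) (L : List (α × Bool)) : ℕ × ℕ :=
  L.foldl (fun s e => chargeStep j s e.2) s

theorem charge_append {α : Type*} (s : ℕ × ℕ) (L L' : List (α × Bool)) :
    charge j s (L ++ L') = charge j (charge j s L) L' :=
  List.foldl_append

/-- The unary balance cannot go below zero and stays there instead, but the failure count never
decreases. It is therefore a faithful record of whether the true balance ever became negative. -/
theorem charge_snd_eq_zero {α : Type*} {s : ℕ × ℕ} {L : List (α × Bool)} :
    (charge j s L).2 = 0 ↔ s.2 = 0 ∧ Balanced (j + 1) s.1 L := by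
  induction L generalizing s with
  | nil => simp [charge, Balanced]
  | cons e L ih =>
    obtain ⟨x, δ⟩ := e
    obtain ⟨q, f⟩ := s
    have hstep : charge j (q, f) ((x, δ) :: L) = charge j (chargeStep j (q, f) δ) L := rfl
    rw [hstep, ih, Balanced]
    cases δ with
    | true => simp [chargeStep, weight]
    | false =>
      cases q with
      | zero =>
        simp only [chargeStep, weight]
        simp only [Bool.false_eq_true, if_false, if_true, Nat.add_eq_zero_iff, one_ne_zero,
          and_false, false_and, Nat.cast_zero, zero_add, le_refl, true_and, false_iff, not_and]
        intro _ h
        have := h.nonneg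
        omega
      | succ q => simp [chargeStep, weight]; intros; positivity

theorem charge_le {α : Type*} (s : ℕ × ℕ) (L : List (α × Bool)) :
    (charge j s L).1 ≤ s.1 + j * L.length ∧ (charge j s L).2 ≤ s.2 + L.length := by
  induction L generalizing s with
  | nil => simp [charge]
  | cons e L ih =>
    have hstep : charge j s (e :: L) = charge j (chargeStep j s e.2) L := rfl
    have h₁ : (chargeStep j s e.2).1 ≤ s.1 + j ∧ (chargeStep j s e.2).2 ≤ s.2 + 1 := by
      unfold chargeStep
      split_ifs <;> constructor <;> dsimp only <;> omega
    have h₂ := ih (chargeStep j s e.2)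
    rw [hstep, List.length_cons, Nat.mul_succ]
    omega

theorem roundTally_eq (u D I : Fin n → Bool) (q f : ℕ) :
    roundTally j u D I q f = ⟨(List.finRange n).map (survives u D I),
      (charge j (q, f) (roundRemoved u D I)).1, (charge j (q, f) (roundRemoved u D I)).2⟩ := by
  have key : ∀ (L : List (Fin n)) (U : List Bool) (q f : ℕ),
      (L.map fun x => (u x, D x, I x)).foldl (Tally.step j) ⟨U, q, f⟩ =
        ⟨(L.map (survives u D I)).reverse ++ U,
          (charge j (q, f) ((L.filter fun x => u x && (D x || I x)).map fun x => (x, D x))).1,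
          (charge j (q, f) ((L.filter fun x => u x && (D x || I x)).map fun x => (x, D x))).2⟩ := by
    intro L
    induction L with
    | nil => intros; rfl
    | cons x L ih =>
      intro U q f
      rw [List.map_cons, List.foldl_cons]
      by_cases h : (u x && (D x || I x)) = true
      · have hs : survives u D I x = false := by
          simp only [Bool.and_eq_true] at h
          simp [survives, h.2]
        rw [List.filter_cons_of_pos (p := fun x => u x && (D x || I x)) h]
        have hstep : Tally.step j ⟨U, q, f⟩ (u x, D x, I x) =
            ⟨false :: U, (chargeStep j (q, f) (D x)).1, (chargeStep j (q, f) (D x)).2⟩ := by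
          simp only [Tally.step, h, if_true, chargeStep]
          split_ifs <;> rfl
        rw [hstep, ih]
        simp [hs, charge]
      · have hs : survives u D I x = u x := by
          rw [Bool.not_eq_true] at h
          simp only [survives]
          cases hu : u x <;> simp_all
        rw [List.filter_cons_of_neg (p := fun x => u x && (D x || I x)) h]
        have hstep : Tally.step j ⟨U, q, f⟩ (u x, D x, I x) = ⟨u x :: U, q, f⟩ := by
          simp only [Tally.step, h]
          rfl
        rw [hstep, ih]
        simp [hs]
  rw [roundTally, key]
  simp [roundRemoved]

variable {k : ℕ} {V : Type*}

/-- Vertices removable in the common set `U` remain removable in any order, since each only has to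
be tested in a subset of `U`. -/
theorem peels_append {H : KHypergraph k V} {R S : List (V × Bool)} {U : Set V}
    (hR : ∀ e ∈ R, H.RemovableAs U e.1 e.2) (hRU : ∀ y ∈ R.map Prod.fst, y ∈ U)
    (hSU : ∀ y ∈ S.map Prod.fst, y ∈ U) (hS : H.Peels S) : H.Peels (R ++ S) := by
  induction R with
  | nil => exact hS
  | cons e R ih =>
    refine ⟨(hR e (by simp)).mono ?_, ih (fun e he => hR e (by simp [he]))
      (fun y hy => hRU y (List.mem_cons_of_mem _ hy))⟩
    intro y hy
    have hy' : y ∈ (e :: R).map Prod.fst ∨ y ∈ S.map Prod.fst := by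
      have : y ∈ ((e :: R) ++ S).map Prod.fst := hy
      rwa [List.map_append, List.mem_append] at this
    exact hy'.elim (hRU y) (hSU y)

/-- `P` is a removal order of the vertices outside of the set given by `u`. -/
structure Removed (H : KHypergraph k V) (P : List (V × Bool)) (u : V → Bool) : Prop where
  peels : ∀ S, H.Peels S → (∀ y ∈ S.map Prod.fst, u y = true) → H.Peels (P ++ S)
  nodup : (P.map Prod.fst).Nodup
  mem : ∀ x, x ∈ P.map Prod.fst ↔ u x = false

theorem Removed.isPeeling {H : KHypergraph k V} {P : List (V × Bool)} {u : V → Bool}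
    (h : H.Removed P u) (hu : ∀ x, u x = false) : H.IsPeeling P where
  peels := by simpa using h.peels [] trivial (by simp)
  nodup := h.nodup
  mem x := (h.mem x).2 (hu x)

/-- The first member of `U` in the order is removable in a set containing `U`. -/
theorem IsPeeling.exists_removableAs {H : KHypergraph k V} {L : List (V × Bool)}
    (hL : H.IsPeeling L) {U : Set V} (hU : U.Nonempty) : ∃ x ∈ U, ∃ δ, H.RemovableAs U x δ := by
  have key : ∀ L : List (V × Bool), H.Peels L → (∀ x ∈ U, x ∈ L.map Prod.fst) →
      ∃ x ∈ U, ∃ δ, H.RemovableAs U x δ := by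
    intro L hp hU'
    induction L with
    | nil =>
      obtain ⟨x, hx⟩ := hU
      simpa using hU' x hx
    | cons e L ih =>
      by_cases he : e.1 ∈ U
      · exact ⟨e.1, he, e.2, hp.1.mono hU'⟩
      · refine ih hp.2 fun x hx => ?_
        have := hU' x hx
        rw [List.map_cons, List.mem_cons] at this
        exact this.resolve_left fun h => he (h ▸ hx)
  exact key L hL.peels fun x _ => hL.mem x

/-- The vertices that remain after a round. -/
noncomputable def nextSet (H : KHypergraph (j + 1) (Fin n)) (u : Fin n → Bool) : Fin n → Bool :=
  survives u (testResult u H.edgeBit j true) (testResult u H.edgeBit j false)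

/-- The designated vertices removed in a round. -/
noncomputable def nextRemoved (H : KHypergraph (j + 1) (Fin n)) (u : Fin n → Bool) :
    List (Fin n × Bool) :=
  roundRemoved u (testResult u H.edgeBit j true) (testResult u H.edgeBit j false)

theorem Removed.next {H : KHypergraph (j + 1) (Fin n)} {P : List (Fin n × Bool)}
    {u : Fin n → Bool} (h : H.Removed P u) : H.Removed (P ++ H.nextRemoved u) (H.nextSet u) := by
  have hmem : ∀ x, x ∈ (H.nextRemoved u).map Prod.fst ↔ u x = true ∧ H.nextSet u x = false := by
    intro x
    rw [nextRemoved, roundRemoved, List.map_map, nextSet]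
    simp only [Function.comp_def, List.map_id', List.mem_filter, List.mem_reverse,
      List.mem_finRange, true_and, survives]
    cases u x <;> cases testResult u H.edgeBit j true x <;>
      cases testResult u H.edgeBit j false x <;> simp
  have hle : ∀ x, H.nextSet u x = true → u x = true := by
    intro x hx
    rw [nextSet, survives, Bool.and_eq_true] at hx
    exact hx.1
  refine ⟨fun S hS hSu => ?_, ?_, fun x => ?_⟩
  · rw [List.append_assoc]
    refine h.peels _ (peels_append (U := {y | u y = true}) ?_ (fun y hy => ((hmem y).1 hy).1)
      (fun y hy => hle y (hSu y hy)) hS) ?_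
    · intro e he
      obtain ⟨x, hx, rfl⟩ := List.mem_map.1 he
      have hx := (List.mem_filter.1 hx).2
      rw [Bool.and_eq_true, Bool.or_eq_true] at hx
      by_cases hd : testResult u H.edgeBit j true x = true
      · simpa only [hd] using testResult_eq_true.1 hd
      · rw [Bool.not_eq_true] at hd
        simp only [hd, Bool.false_eq_true, false_or] at hx ⊢
        exact testResult_eq_true.1 hx.2
    · intro y hy
      rw [List.map_append, List.mem_append] at hy
      exact hy.elim (fun hy => ((hmem y).1 hy).1) (fun hy => hle y (hSu y hy))
  · rw [List.map_append, List.nodup_append]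
    refine ⟨h.nodup, ?_, ?_⟩
    · rw [nextRemoved, roundRemoved, List.map_map]
      simp only [Function.comp_def, List.map_id']
      exact (List.nodup_reverse.2 (List.nodup_finRange n)).filter _
    · rintro x hx y hy rfl
      have h₁ := (h.mem x).1 hx
      have h₂ := ((hmem x).1 hy).1
      rw [h₁] at h₂
      exact Bool.false_ne_true h₂
  · rw [List.map_append, List.mem_append, h.mem, hmem]
    cases hu : u x with
    | true => simp
    | false =>
      simp only [true_or, true_iff]
      by_contra hne
      rw [Bool.not_eq_false] at hne
      rw [hle x hne] at hu
      exact Bool.false_ne_true hu.symm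

/-- In the orderable case a round cannot get stuck on a nonempty set, so each round removes at least
one vertex; this limits the number of rounds to `n`. -/
theorem card_nextSet {H : KHypergraph (j + 1) (Fin n)} (hH : H.Orderable) (u : Fin n → Bool) :
    (Finset.univ.filter fun x => H.nextSet u x = true).card ≤
      (Finset.univ.filter fun x => u x = true).card - 1 := by
  have hle : ∀ x, H.nextSet u x = true → u x = true := by
    intro x hx
    rw [nextSet, survives, Bool.and_eq_true] at hx
    exact hx.1
  have hsub : (Finset.univ.filter fun x => H.nextSet u x = true) ⊆
      Finset.univ.filter fun x => u x = true := fun x hx => by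
    simp only [Finset.mem_filter, Finset.mem_univ, true_and] at hx ⊢
    exact hle x hx
  rcases (Finset.univ.filter fun x => u x = true).eq_empty_or_nonempty with h0 | ⟨x, hx⟩
  · rw [h0] at hsub ⊢
    simp [Finset.subset_empty.1 hsub]
  · obtain ⟨L, hL⟩ := orderable_iff_exists_isPeeling.1 hH
    obtain ⟨y, hy, δ, hδ⟩ := hL.exists_removableAs (U := {y | u y = true})
      ⟨x, (Finset.mem_filter.1 hx).2⟩
    have hlt := Finset.card_lt_card (Finset.ssubset_iff_subset_ne.2 ⟨hsub, fun he => ?_⟩)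
    · omega
    · have hmem : y ∈ Finset.univ.filter fun x => u x = true :=
        Finset.mem_filter.2 ⟨Finset.mem_univ _, hy⟩
      rw [← he, Finset.mem_filter] at hmem
      have := hmem.2
      rw [nextSet, survives, Bool.and_eq_true, Bool.not_eq_true', Bool.or_eq_false_iff] at this
      rw [← testResult_eq_true] at hδ
      cases δ
      · rw [hδ] at this
        exact Bool.false_ne_true this.2.2.symm
      · rw [hδ] at this
        exact Bool.false_ne_true this.2.1.symm

/-- The state of the algorithm: remaining vertices, balance and failure count. -/
abbrev RoundState (n : ℕ) : Type := (Fin n → Bool) × ℕ × ℕ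

/-- The effect of a round. -/
noncomputable def nextState (H : KHypergraph (j + 1) (Fin n)) (s : RoundState n) : RoundState n :=
  (H.nextSet s.1, charge j s.2 (H.nextRemoved s.1))

/-- The initial state. -/
def initState (n : ℕ) : RoundState n := (fun _ => true, 0, 0)

theorem exists_removed (H : KHypergraph (j + 1) (Fin n)) (i : ℕ) :
    ∃ P, H.Removed P (H.nextState^[i] (initState n)).1 ∧
      (H.nextState^[i] (initState n)).2 = charge j (0, 0) P := by
  induction i with
  | zero => exact ⟨[], ⟨fun S hS _ => hS, by simp, fun x => by simp [initState]⟩, rfl⟩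
  | succ i ih =>
    obtain ⟨P, hP, hc⟩ := ih
    rw [Function.iterate_succ_apply']
    exact ⟨_, hP.next, by rw [nextState, charge_append, hc]⟩

theorem card_iterate {H : KHypergraph (j + 1) (Fin n)} (hH : H.Orderable) (i : ℕ) :
    (Finset.univ.filter fun x => (H.nextState^[i] (initState n)).1 x = true).card ≤ n - i := by
  induction i with
  | zero => exact (Finset.card_le_univ _).trans (by simp)
  | succ i ih =>
    rw [Function.iterate_succ_apply']
    refine (card_nextSet hH _).trans ?_
    omega

/-- The counters are kept in unary, so these bounds limit the time for emptying their stacks. -/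
theorem iterate_le (H : KHypergraph (j + 1) (Fin n)) (i : ℕ) :
    (H.nextState^[i] (initState n)).2.1 ≤ i * (j * n) ∧
      (H.nextState^[i] (initState n)).2.2 ≤ i * n := by
  induction i with
  | zero => simp [initState]
  | succ i ih =>
    rw [Function.iterate_succ_apply', nextState]
    set s := H.nextState^[i] (initState n)
    have hlen : (H.nextRemoved s.1).length ≤ n := by
      rw [nextRemoved, roundRemoved, List.length_map]
      exact (List.length_filter_le _ _).trans (by simp)
    have h := charge_le (j := j) s.2 (H.nextRemoved s.1)
    have h' : j * (H.nextRemoved s.1).length ≤ j * n := Nat.mul_le_mul_left j hlen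
    rw [Nat.succ_mul, Nat.succ_mul]
    dsimp only
    exact ⟨by omega, by omega⟩

/-- The state after all rounds. -/
noncomputable def finalState (H : KHypergraph (j + 1) (Fin n)) : RoundState n :=
  H.nextState^[n] (initState n)

theorem orderable_iff_finalState (H : KHypergraph (j + 1) (Fin n)) :
    H.Orderable ↔ ∀ x, H.finalState.1 x = false := by
  constructor
  · intro hH x
    have := card_iterate hH n
    rw [Nat.sub_self, Nat.le_zero, Finset.card_eq_zero, Finset.filter_eq_empty_iff] at this
    simpa [finalState] using this (Finset.mem_univ x)
  · intro h
    obtain ⟨P, hP, -⟩ := H.exists_removed n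
    exact orderable_iff_exists_isPeeling.2 ⟨P, hP.isPeeling h⟩

theorem hasPerfectMatching_iff_finalState {H : KHypergraph (j + 1) (Fin n)} (hH : H.Orderable) :
    H.HasPerfectMatching ↔ H.finalState.2.2 = 0 ∧ j + 1 ∣ n := by
  obtain ⟨P, hP, hc⟩ := H.exists_removed n
  have hpeel := hP.isPeeling ((orderable_iff_finalState H).1 hH)
  have hlen : P.length = n := by
    have h₁ : (P.map Prod.fst).toFinset = Finset.univ := by
      ext x
      simpa using hpeel.mem x
    have h₂ := List.toFinset_card_of_nodup hpeel.nodup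
    rw [h₁, Finset.card_univ, Fintype.card_fin, List.length_map] at h₂
    exact h₂.symm
  rw [hpeel.hasPerfectMatching_iff, hlen, finalState, hc, charge_snd_eq_zero, and_comm]
  simp

end Correctness

end KHypergraph

/-! ### The complete decision procedures -/

namespace KHypergraph

open StackProg StackMemory

section Main

/-- The memory with empty stacks. -/
def Mem.empty : Mem := ⟨[], [], [], [], [], [], [], [], [], [], [], [], []⟩

theorem Mem.get_empty_w (l : List Bool) :
    StackMemory.get { Mem.empty with w := l } = Function.update (fun _ => []) Stack.w l := by
  funext k
  cases k <;> rfl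

/-- Read the number of vertices and set up the counters, leaving the adjacency tensor on `w`. -/
def initProg : StackProg Stack :=
  seq (loop .w fun b => cond b (seq (push .u true) (seq (push .n true) (push .c true)))
    (move .w .t)) (move .t .w)

theorem run_initProg_loop (m : Mem) (i i' : ℕ) (W : List Bool) :
    Run (loop .w fun b => cond b (seq (push .u true) (seq (push .n true) (push .c true)))
      (move .w .t))
      { m with w := List.replicate i true ++ false :: W, u := List.replicate i' true,
               n := List.replicate i' true, c := List.replicate i' true, t := [] }
      (4 * i + 2 * W.length + 3)
      { m with w := [], u := List.replicate (i' + i) true, n := List.replicate (i' + i) true,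
               c := List.replicate (i' + i) true, t := W.reverse } := by
  induction i generalizing i' with
  | zero =>
    -- At the separating `false` the body moves all of the tensor to `t`, so the loop finds `w`
    -- empty and stops.
    refine Run.cast (Run.loop_cons rfl (run_move (by decide) _) (Run.loop_nil rfl)) ?_ ?_
    · simp [StackMemory.get, StackMemory.set, Mem.get, Mem.set]
    · simp [StackMemory.get, StackMemory.set, Mem.get, Mem.set]
      omega
  | succ i ih =>
    refine Run.cast (Run.loop_cons rfl (Run.seq (Run.push _ _ _)
      (Run.seq (Run.push _ _ _) (Run.push _ _ _))) (ih (i' + 1))) ?_ ?_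
    · rw [show i' + 1 + i = i' + (i + 1) by omega]
    · omega

theorem run_initProg (n : ℕ) (W : List Bool) :
    Run initProg { Mem.empty with w := List.replicate n true ++ false :: W }
      (4 * n + 4 * W.length + 4)
      { Mem.empty with w := W, u := List.replicate n true, n := List.replicate n true,
                       c := List.replicate n true } := by
  refine Run.cast (Run.seq (run_initProg_loop Mem.empty n 0 W) (run_move (by decide) _)) ?_ ?_
  · simp [StackMemory.get, StackMemory.set, Mem.get, Mem.set, Mem.empty]
  · simp [StackMemory.get, Mem.get]
    omega

/-- The memory between two rounds. -/
noncomputable def roundMem {j n : ℕ} (H : KHypergraph (j + 1) (Fin n)) (s : RoundState n) (i : ℕ) :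
    Mem :=
  { Mem.empty with
    w := (tuples n (j + 1)).map H.edgeBit, u := (List.finRange n).map s.1,
    n := List.replicate n true, c := List.replicate i true, q := List.replicate s.2.1 true,
    f := List.replicate s.2.2 true }

theorem run_rounds {j n : ℕ} (H : KHypergraph (j + 1) (Fin n)) (hn : 0 < n) (N i : ℕ)
    (s : RoundState n) (hN : n ^ (j + 1) ≤ N) :
    Run (loop .c fun _ => roundProg j) (roundMem H s i)
      (i * (2 * testTime j N + N * (j + 12) + 5) + 1)
      (roundMem H (H.nextState^[i] s) 0) := by
  induction i generalizing s with
  | zero => exact (Run.loop_nil rfl).mono (by omega)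
  | succ i ih =>
    have h := run_roundProg (roundMem H s i) hn s.1 H.edgeBit j N s.2.1 s.2.2 hN
    rw [roundTally_eq] at h
    refine Run.cast (Run.loop_cons rfl h (ih (H.nextState s))) rfl ?_
    ring_nf
    omega

/-- Output whether the stack `f` is empty, and empty it. -/
def answerProg : StackProg Stack :=
  pop .f (push .w true) fun _ => seq (drop .f) (push .w false)

theorem run_answerProg (m : Mem) (i : ℕ) :
    Run answerProg { m with w := [], f := List.replicate i true } (2 * i + 3)
      { m with w := [decide (i = 0)], f := [] } := by
  cases i with
  | zero => exact (Run.pop_nil rfl (Run.push _ _ _)).mono (by omega)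
  | succ i =>
    refine Run.cast (Run.pop_cons rfl (Run.seq (run_drop _ _) (Run.push _ _ _))) ?_ ?_
    · simp [StackMemory.get, StackMemory.set, Mem.get, Mem.set]
    · simp [StackMemory.get, StackMemory.set, Mem.get, Mem.set]
      omega

/-- Record on `f` every bit `true` on `u`. -/
def collectProg : StackProg Stack := loop .u fun b => cond b (push .f true) skip

theorem run_collectProg (m : Mem) (U : List Bool) (i : ℕ) :
    Run collectProg { m with u := U, f := List.replicate i true } (2 * U.length + 1)
      { m with u := [], f := List.replicate (i + U.count true) true } := by
  induction U generalizing i with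
  | nil => exact Run.loop_nil rfl
  | cons b U ih =>
    cases b with
    | true =>
      refine Run.cast (Run.loop_cons rfl (Run.push _ _ _) (ih (i + 1))) ?_ ?_
      · rw [List.count_cons_self, show i + 1 + U.count true = i + (U.count true + 1) by omega]
      · rw [List.length_cons]
        omega
    | false =>
      refine Run.cast (Run.loop_cons rfl (Run.skip _) (ih i)) ?_ ?_
      · simp
      · rw [List.length_cons]
        omega

/-- Record on `f` if the length of `n` is not divisible by `j + 1`. -/
def divideProg (j : ℕ) : StackProg Stack :=
  loop .n fun _ => rep j (pop .n (push .f true) fun _ => skip)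

/-- A pop from the empty stack leaves a failure mark; the two truncated differences count the
remaining items and the failed pops. -/
theorem run_divideProg_step (m : Mem) (j i g : ℕ) :
    Run (rep j (pop .n (push .f true) fun _ => skip))
      { m with n := List.replicate i true, f := List.replicate g true } (2 * j + 1)
      { m with n := List.replicate (i - j) true, f := List.replicate (g + (j - i)) true } := by
  induction j generalizing i g with
  | zero =>
    refine Run.cast (Run.skip _) ?_ le_rfl
    rw [Nat.zero_sub, Nat.add_zero, Nat.sub_zero]
  | succ j ih =>
    cases i with
    | zero =>
      refine Run.cast (Run.seq (Run.pop_nil rfl (Run.push _ _ _)) (ih 0 (g + 1))) ?_ (by omega)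
      rw [show g + 1 + (j - 0) = g + (j + 1 - 0) by omega, Nat.zero_sub, Nat.zero_sub]
    | succ i =>
      refine Run.cast (Run.seq (Run.pop_cons rfl (Run.skip _)) (ih i g)) ?_ (by omega)
      rw [Nat.add_sub_add_right, Nat.add_sub_add_right]

/-- Each iteration consumes a group of `j + 1` items, and an incomplete last group leaves at least
one mark. Only whether marks exist matters, so `g'` is not computed. -/
theorem run_divideProg (m : Mem) (j i g : ℕ) :
    ∃ g', Run (divideProg j) { m with n := List.replicate i true, f := List.replicate g true }
      (i * (2 * j + 2) + 1) { m with n := [], f := List.replicate g' true } ∧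
      g' ≤ g + j * i ∧ (g' = 0 ↔ g = 0 ∧ j + 1 ∣ i) := by
  induction i using Nat.strong_induction_on generalizing g with
  | _ i ih =>
    cases i with
    | zero => exact ⟨g, Run.cast (Run.loop_nil rfl) rfl (by omega), by omega, by simp⟩
    | succ i =>
      obtain ⟨g', h₁, h₂, h₃⟩ := ih (i - j) (by omega) (g + (j - i))
      refine ⟨g', Run.cast (Run.loop_cons rfl (run_divideProg_step m j i g) h₁) rfl ?_, ?_, ?_⟩
      · have : (i - j) * (2 * j + 2) ≤ i * (2 * j + 2) := Nat.mul_le_mul_right _ (Nat.sub_le _ _)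
        have e : (i + 1) * (2 * j + 2) = i * (2 * j + 2) + (2 * j + 2) := by ring
        rw [e]
        omega
      · have : j * (i - j) ≤ j * i := Nat.mul_le_mul_left _ (Nat.sub_le _ _)
        rw [Nat.mul_succ]
        omega
      · rw [h₃]
        rcases Nat.lt_or_ge i j with hlt | hge
        · have : ¬ j + 1 ∣ i + 1 := fun h => by
            have := Nat.le_of_dvd (by omega) h
            omega
          simp only [this, and_false, iff_false]
          omega
        · have : i + 1 = (i - j) + (j + 1) := by omega
          rw [this, Nat.dvd_add_self_right]
          simp
          omega

/-- Perform all rounds. -/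
def removalProg (j : ℕ) : StackProg Stack := seq initProg (loop .c fun _ => roundProg j)

/-- A bound on the running time of `removalProg`. -/
def removalTime (j N : ℕ) : ℕ := 8 * N + N * (2 * testTime j N + N * (j + 12) + 5) + 5

theorem length_encode {k : ℕ} (H : Σ n : ℕ, KHypergraph k (Fin n)) :
    (encode H).length = H.1 + H.1 ^ k + 1 := by
  simp [encode, length_tuples]
  omega

theorem run_removalProg {j n : ℕ} (H : KHypergraph (j + 1) (Fin n)) (N : ℕ) (hn : n ≤ N)
    (hN : n ^ (j + 1) ≤ N) :
    Run (removalProg j) { Mem.empty with w := encode ⟨n, H⟩ } (removalTime j N)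
      (roundMem H H.finalState 0) := by
  have h₁ := run_initProg n ((tuples n (j + 1)).map H.edgeBit)
  have hmem : { Mem.empty with w := (tuples n (j + 1)).map H.edgeBit, u := List.replicate n true,
                               n := List.replicate n true, c := List.replicate n true } =
      roundMem H (initState n) n := by
    simp [roundMem, initState, Mem.empty]
  have h₂ : Run (loop .c fun _ => roundProg j) (roundMem H (initState n) n)
      (n * (2 * testTime j N + N * (j + 12) + 5) + 1) (roundMem H H.finalState 0) := by
    -- For `n = 0` the block programs do not apply, but the round counter is empty and no round is
    -- run.
    rcases Nat.eq_zero_or_pos n with rfl | hpos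
    · exact Run.cast (Run.loop_nil rfl) rfl (by omega)
    · exact run_rounds H hpos N n _ hN
  rw [hmem] at h₁
  refine Run.cast (Run.seq h₁ h₂) rfl ?_
  have : n * (2 * testTime j N + N * (j + 12) + 5) ≤ N * (2 * testTime j N + N * (j + 12) + 5) :=
    Nat.mul_le_mul_right _ hn
  rw [List.length_map, length_tuples]
  unfold removalTime
  omega

/-- The program deciding orderability, for edge size `j + 1`. -/
def orderableProg (j : ℕ) : StackProg Stack :=
  seq (removalProg j) <| seq (drop .w) <| seq (drop .n) <| seq (drop .q) <| seq (drop .f) <|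
    seq collectProg answerProg

/-- The program deciding whether an orderable hypergraph has a perfect matching, for edge size
`j + 1`. -/
def matchingProg (j : ℕ) : StackProg Stack :=
  seq (removalProg j) <| seq (drop .w) <| seq (drop .u) <| seq (drop .q) <|
    seq (divideProg j) answerProg

/-- A bound on the running time of `orderableProg` and `matchingProg`. -/
def totalTime (j N : ℕ) : ℕ :=
  removalTime j N + 8 * N + 2 * (N * (j * N)) + 2 * (N * N) + N * (2 * j + 2) + 2 * (j * N) + 8

theorem run_orderableProg {j n : ℕ} (H : KHypergraph (j + 1) (Fin n)) (N : ℕ) (hn : n ≤ N)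
    (hN : n ^ (j + 1) ≤ N) :
    Run (orderableProg j) { Mem.empty with w := encode ⟨n, H⟩ } (totalTime j N)
      { Mem.empty with w := open Classical in [decide H.Orderable] } := by
  have hcount : ((List.finRange n).map H.finalState.1).count true ≤ n := by
    refine List.count_le_length.trans ?_
    simp
  -- The emptied failure stack is used again, now to count the vertices that were never removed.
  have hanswer : (0 + ((List.finRange n).map H.finalState.1).count true = 0) ↔ H.Orderable := by
    rw [orderable_iff_finalState, zero_add, List.count_eq_zero]
    simp
  have h := run_answerProg { Mem.empty with u := [] }
    (0 + ((List.finRange n).map H.finalState.1).count true)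
  refine Run.cast (Run.seq (run_removalProg H N hn hN) (Run.seq (run_drop _ _)
    (Run.seq (run_drop _ _) (Run.seq (run_drop _ _) (Run.seq (run_drop _ _)
      (Run.seq (run_collectProg Mem.empty ((List.finRange n).map H.finalState.1) 0) h)))))) ?_ ?_
  · exact congrArg (fun b => { Mem.empty with w := [b] }) (decide_eq_decide.2 hanswer)
  · have h₁ := (H.iterate_le n).1
    have h₂ := (H.iterate_le n).2
    have h₃ : n * (j * n) ≤ N * (j * N) := by gcongr
    have h₄ : n * n ≤ N * N := by gcongr
    simp only [StackMemory.get, StackMemory.set, Mem.get, Mem.set, roundMem, List.length_map,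
      length_tuples, List.length_replicate, List.length_finRange, totalTime, finalState]
      at hcount ⊢
    omega

/-- Negative balances and failed division leave marks on the same stack, so one test for emptiness
checks both conditions. -/
theorem run_matchingProg {j n : ℕ} (H : KHypergraph (j + 1) (Fin n)) (hH : H.Orderable) (N : ℕ)
    (hn : n ≤ N) (hN : n ^ (j + 1) ≤ N) :
    Run (matchingProg j) { Mem.empty with w := encode ⟨n, H⟩ } (totalTime j N)
      { Mem.empty with w := open Classical in [decide H.HasPerfectMatching] } := by
  obtain ⟨g, h₁, h₂, h₃⟩ := run_divideProg Mem.empty j n H.finalState.2.2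
  rw [← hasPerfectMatching_iff_finalState hH] at h₃
  refine Run.cast (Run.seq (run_removalProg H N hn hN) (Run.seq (run_drop _ _)
    (Run.seq (run_drop _ _) (Run.seq (run_drop _ _)
      (Run.seq h₁ (run_answerProg { Mem.empty with n := [] } g)))))) ?_ ?_
  · exact congrArg (fun b => { Mem.empty with w := [b] }) (decide_eq_decide.2 h₃)
  · have h₄ := (H.iterate_le n).1
    have h₅ := (H.iterate_le n).2
    have h₆ : n * (j * n) ≤ N * (j * N) := by gcongr
    have h₇ : n * n ≤ N * N := by gcongr
    have h₈ : n * (2 * j + 2) ≤ N * (2 * j + 2) := by gcongr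
    have h₉ : j * n ≤ j * N := by gcongr
    simp only [StackMemory.get, StackMemory.set, Mem.get, Mem.set, roundMem, List.length_map,
      length_tuples, List.length_replicate, List.length_finRange, totalTime, finalState]
      at h₂ ⊢
    omega

open Polynomial in
theorem exists_polynomial_totalTime (j : ℕ) : ∃ P : ℕ[X], ∀ N, P.eval N = totalTime j N := by
  let T : ℕ[X] := 5 * X + 2 + ((j : ℕ[X]) * (X * (7 * X ^ 2 + 17 * X + 7) + 2) + 1) + (8 * X + 3) +
    ((j : ℕ[X]) * (X * (8 * X + 9) + 2) + 1)
  refine ⟨(8 * X + X * (2 * T + X * ((j : ℕ[X]) + 12) + 5) + 5) + 8 * X +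
    2 * (X * ((j : ℕ[X]) * X)) + 2 * (X * X) + X * (2 * (j : ℕ[X]) + 2) + 2 * ((j : ℕ[X]) * X) + 8,
    fun N => ?_⟩
  simp [T, totalTime, removalTime, testTime]

/-- No vertex lies in a set of size `0`, so every vertex is vacuously dominating. -/
theorem orderable_of_zero {n : ℕ} (H : KHypergraph 0 (Fin n)) : H.Orderable :=
  ⟨n, Equiv.refl _, fun i => Or.inl fun E hE hx _ => by
    rw [Finset.card_eq_zero.1 hE] at hx
    exact absurd hx (Finset.notMem_empty _)⟩

theorem hasPerfectMatching_iff_of_zero {n : ℕ} (H : KHypergraph 0 (Fin n)) :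
    H.HasPerfectMatching ↔ n = 0 := by
  constructor
  · rintro ⟨M, h₁, -, h₂⟩
    by_contra hn
    obtain ⟨E, hE, hx⟩ := h₂ ⟨0, Nat.pos_of_ne_zero hn⟩
    rw [Finset.card_eq_zero.1 (H.card_eq E (h₁ E hE))] at hx
    exact Finset.notMem_empty _ hx
  · rintro rfl
    exact ⟨∅, by simp, by simp, fun x => x.elim0⟩

theorem decidableInPolyTime_orderable (k : ℕ) : DecidableInPolyTime encode
    (fun H : (Σ n : ℕ, KHypergraph k (Fin n)) => H.2.Orderable) := by
  cases k with
  | zero =>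
    refine decidableInPolyTime (S := Mem) (seq (drop .w) (push .w true)) .w (2 * .X + 2) fun H =>
      ⟨_, _, Mem.get_empty_w _, Mem.get_empty_w _, Run.cast (Run.seq (run_drop _ _)
        (Run.push _ _ _)) ?_ ?_⟩
    · simp [StackMemory.get, StackMemory.set, Mem.get, Mem.set, orderable_of_zero, Mem.empty]
    · simp [StackMemory.get, Mem.get]
  | succ j =>
    obtain ⟨P, hP⟩ := exists_polynomial_totalTime j
    refine decidableInPolyTime (S := Mem) (orderableProg j) .w P fun H =>
      ⟨_, _, Mem.get_empty_w _, Mem.get_empty_w _, ?_⟩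
    -- The bound `N` is the input length `n + n ^ (j + 1) + 1`, which exceeds both `n` and the size
    -- of the tensor.
    rw [hP, length_encode]
    exact run_orderableProg H.2 _ (by omega) (by omega)

theorem decidableInPolyTime_hasPerfectMatching (k : ℕ) : DecidableInPolyTime
    (fun H : {H : Σ n : ℕ, KHypergraph k (Fin n) // H.2.Orderable} => encode H.1)
    (fun H => H.1.2.HasPerfectMatching) := by
  cases k with
  | zero =>
    refine decidableInPolyTime (S := Mem)
      (pop .w skip fun b => seq (drop .w) (push .w (!b))) .w (2 * .X + 3) fun H =>
      ⟨{ Mem.empty with w := encode H.1 }, _, Mem.get_empty_w _, Mem.get_empty_w _, ?_⟩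
    obtain ⟨⟨n, H⟩, hH⟩ := H
    -- For `k = 0` the empty edge covers nothing, so the answer is whether `n = 0`, and this can be
    -- read off the first input bit.
    obtain ⟨b, l, hl, hb⟩ : ∃ b l, encode ⟨n, H⟩ = b :: l ∧ (b = false ↔ n = 0) := by
      cases n with
      | zero => exact ⟨_, _, rfl, by simp⟩
      | succ n => exact ⟨_, _, rfl, by simp⟩
    dsimp only
    rw [hl]
    refine Run.cast (Run.pop_cons rfl (Run.seq (run_drop _ _) (Run.push _ _ _))) ?_ ?_
    · simp only [StackMemory.get, StackMemory.set, Mem.get, Mem.set, Mem.empty,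
        hasPerfectMatching_iff_of_zero, ← hb]
      cases b <;> simp
    · simp [StackMemory.get, StackMemory.set, Mem.get, Mem.set]
      omega
  | succ j =>
    obtain ⟨P, hP⟩ := exists_polynomial_totalTime j
    refine decidableInPolyTime (S := Mem) (matchingProg j) .w P fun H =>
      ⟨_, _, Mem.get_empty_w _, Mem.get_empty_w _, ?_⟩
    rw [hP, length_encode]
    exact run_matchingProg H.1.2 H.2 _ (by omega) (by omega)

end Main

end KHypergraph

theorem theorem1 (k : ℕ) :
    -- orderability is decidable in polynomial time
    DecidableInPolyTime KHypergraph.encode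
      (fun H : (Σ n : ℕ, KHypergraph k (Fin n)) => H.2.Orderable) ∧
    -- perfect matching in orderable hypergraphs is decidable in polynomial time
    DecidableInPolyTime
      (fun H : {H : Σ n : ℕ, KHypergraph k (Fin n) // H.2.Orderable} => KHypergraph.encode H.1)
      (fun H => H.1.2.HasPerfectMatching) ∧
    -- orderability is decided by recursively removing a dominating or isolating vertex
    (∀ (V : Type*) [Finite V] (H : KHypergraph k V),
      (Nat.card V ≤ k → H.Orderable) ∧
      (k < Nat.card V → (H.Orderable ↔
        ∃ x : V, (H.DominatingIn Set.univ x ∨ H.IsolatingIn Set.univ x) ∧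
          (H.delete x).Orderable)) ∧
      ∀ x : V, H.DominatingIn Set.univ x ∨ H.IsolatingIn Set.univ x →
        (H.Orderable ↔ (H.delete x).Orderable)) ∧
    -- the criterion for a perfect matching, for every elimination order
    (∀ (V : Type*) (H : KHypergraph k V) (n : ℕ) (v : Fin n ≃ V),
      H.IsEliminationOrder v →
        (H.HasPerfectMatching ↔ k ∣ n ∧ ∀ j : Fin n, 0 ≤ H.balance v j)) := by
  refine ⟨KHypergraph.decidableInPolyTime_orderable k,
    KHypergraph.decidableInPolyTime_hasPerfectMatching k, fun V _ H => ?_,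
    fun V H n v hv => hv.hasPerfectMatching_iff⟩
  exact ⟨KHypergraph.orderable_of_card_le, KHypergraph.orderable_iff_exists_delete,
    fun x hx => KHypergraph.orderable_iff_delete hx⟩
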